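/- Setting. Let $\mathcal X$ be a measurable space, $\mathcal Y=\{-1,1\}$, and let $\mathcal H\subseteq\mathcal Y^{\mathcal X}$ be a class of measurable functions of finite VC dimension $d$. Let $\mathcal A$ be any ERM learner for $\mathcal H$: for every finite sequence $S$ in $\mathcal X\times\mathcal Y$, $\mathcal A(S)\in\mathcal H$ makes the least possible number of errors on $S$ among the members of $\mathcal H$; the learner is measurable in the sense that $(S,x)\mapsto\mathcal A(S)(x)$ is jointly measurable on $(\mathcal X\times\mathcal Y)^n\times\mathcal X$ for every $n$. For a probability distribution $\mathcal D$ on $\mathcal X\times\mathcal Y$ put $\tau=\inf_{h\in\mathcal H}\Pr_{(x,y)\sim\mathcal D}[h(x)\neq y]$. Splitting. For finite sequences $S,T$ in $\mathcal X\times\mathcal Y$ with $|S|=3^k$, define a list $\mathcal S(S;T)$ of training sequences recursively ($\sqcup$ is concatenation). If $k<6$, $\mathcal S(S;T)$ has the single entry $S\sqcup T$. If $k\ge 6$, cut $S$ into $27$ consecutive blocks $S_1,\dots,S_{27}$ of length $3^{k-3}$, let $S_{i,\sqcup}$ be the first $3^{k-6}$ entries of $S_i$ and $S_{i,\sqcap}$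 the remaining ones, and let $\mathcal S(S;T)$ be the concatenation of the lists $\mathcal S(S_{i,\sqcup};\,S_{i,\sqcap}\sqcup T)$, $i=1,\dots,27$. Let $\widehat{\mathcal A}_{\mathbf t}(S)=(\hat h_1,\dots,\hat h_t)$ be $t$ hypotheses drawn independently and uniformly, with replacement, from the multiset $\{\mathcal A(S')\}_{S'\in\mathcal S(S;\emptyset)}$. Theorem. There is a universal constant $c\ge 1$ such that for all $\mathcal X,\mathcal H,d,\mathcal A,\mathcal D$ as above, every $0<\delta<1$, every $m=3^k$ with $k\ge 6$, and every natural number $$t\ \ge\ 4\cdot 243^2\,\ln\!\left(\frac{2m}{\delta\,(d+\ln(1/\delta))}\right),$$ with probability at least $1-\delta$ over $\mathbf S\sim\mathcal D^m$ and the independent draw of the $t$ hypotheses of $\widehat{\mathcal A}_{\mathbf t}(\mathbf S)$, $$\Pr_{(x,y)\sim\mathcal D}\!\left[\frac1t\sum_{i=1}^t\mathbf 1\{\hat h_i(x)\ne y\}\ \ge\ \frac{11}{243}\right]\ \le\ c\,\tau+\frac{c\,(d+\ln(e/\delta))}{m}.$$ (For $t=0$, which the condition allows only when $\delta(d+\ln(1/\delta))\ge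 2m$, the average is read as $0$.) -/

import Mathlib

open MeasureTheory ProbabilityTheory

noncomputable section

namespace AgnosticVoting

/-- The label set `{-1, 1}`. -/
abbrev Label : Type := ℤˣ

/-- A hypothesis (classifier) on the domain `X`. -/
abbrev Hyp (X : Type*) : Type _ := X → Label

/-- A learner maps finite training sequences to hypotheses. -/
abbrev Learner (X : Type*) : Type _ := List (X × Label) → Hyp X

/-- `H` shatters the finite set `F`: every labelling of `F` is realized by a member of `H`. -/
def Shatters {X : Type*} (H : Set (Hyp X)) (F : Finset X) : Prop :=
  ∀ g : Hyp X, ∃ h ∈ H, ∀ x ∈ F, h x = g x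

/-- `H` has (finite) VC dimension `d`: the largest size of a shattered set is `d`. -/
def HasVCDim {X : Type*} (H : Set (Hyp X)) (d : ℕ) : Prop :=
  IsGreatest {n : ℕ | ∃ F : Finset X, F.card = n ∧ Shatters H F} d

/-- The true error `P_{(x,y) ∼ D}[h x ≠ y]`. -/
def trueError {X : Type*} [MeasurableSpace X] (D : Measure (X × Label)) (h : Hyp X) : ℝ :=
  D.real {z | h z.1 ≠ z.2}

/-- The error `τ` of the best hypothesis of `H`. -/
def bestError {X : Type*} [MeasurableSpace X] (D : Measure (X × Label)) (H : Set (Hyp X)) : ℝ :=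
  sInf (trueError D '' H)

/-- The empirical error of `h` on `S`: the fraction of the entries of `S` on which `h` errs. -/
def empError {X : Type*} (S : List (X × Label)) (h : Hyp X) : ℝ :=
  (S.countP fun z => h z.1 ≠ z.2 : ℕ) / (S.length : ℝ)

/-- `A` is an empirical risk minimization learner for `H`. -/
def IsERM {X : Type*} (H : Set (Hyp X)) (A : Learner X) : Prop :=
  ∀ S, A S ∈ H ∧ ∀ h ∈ H, empError S (A S) ≤ empError S h

/-- Measurability of a learner: on training sequences of each length `n`, the prediction
`A(S)(x)` is jointly measurable in `(S, x)`. -/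
def IsMeasurableLearner {X : Type*} [MeasurableSpace X] (A : Learner X) : Prop :=
  ∀ n : ℕ, Measurable fun p : (Fin n → X × Label) × X => A (List.ofFn p.1) p.2

/-- The `i`-th (`0 ≤ i < 27`) of the 27 consecutive blocks, each of length `3 ^ (k - 3)`,
of a sequence of length `3 ^ k`. -/
def block {Z : Type*} (k : ℕ) (S : List Z) (i : ℕ) : List Z :=
  (S.drop (i * 3 ^ (k - 3))).take (3 ^ (k - 3))

/-- The recursive 27-way splitting algorithm on input `(S; T)` with `|S| = 3 ^ k`. If `6 ≤ k`, the
block `S_i` is cut into its first `3 ^ (k - 6)` entries, on which the algorithm recurses, and the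
remaining ones, which are prepended to `T`; if `k < 6`, the only output is `S ⊔ T`. -/
def split {Z : Type*} (k : ℕ) (S T : List Z) : List (List Z) :=
  if 6 ≤ k then
    (List.range 27).flatMap fun i =>
      split (k - 6) ((block k S i).take (3 ^ (k - 6))) ((block k S i).drop (3 ^ (k - 6)) ++ T)
  else [S ++ T]
termination_by k

/-- The splitting algorithm produces `27 ^ ⌊k / 6⌋` training sequences. -/
theorem length_split {Z : Type*} (k : ℕ) (S T : List Z) :
    (split k S T).length = 27 ^ (k / 6) := by
  induction k using Nat.strong_induction_on generalizing S T with
  | _ k ih =>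
    rw [split]
    split_ifs with hk
    · have hlt : k - 6 < k := by omega
      have hd : k / 6 = (k - 6) / 6 + 1 := by omega
      simp only [List.length_flatMap, ih _ hlt, List.map_const', List.sum_replicate,
        List.length_range, smul_eq_mul]
      rw [hd, pow_succ, mul_comm]
    · have : k / 6 = 0 := by omega
      simp [this]

/-- The multiset of hypotheses `A(S; T)`, listed as a family: run `A` on every training sequence
produced by the splitting algorithm on `(S; T)`. -/
def allVoters {X : Type*} (A : Learner X) (k : ℕ) (S T : List (X × Label)) :
    Fin (27 ^ (k / 6)) → Hyp X :=
  fun j => A ((split k S T).get (j.cast (length_split k S T).symm))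

/-- The law of `t` independent draws, uniform with replacement, from the `27 ^ ⌊k / 6⌋` indices. -/
def drawLaw (k t : ℕ) : Measure (Fin t → Fin (27 ^ (k / 6))) :=
  Measure.pi fun _ => uniformOn Set.univ

/-- The `t` hypotheses drawn from `A(S; ∅)` when the draws are `r`. -/
def drawnVoters {X : Type*} (A : Learner X) (k : ℕ) {t : ℕ} (S : List (X × Label))
    (r : Fin t → Fin (27 ^ (k / 6))) : Fin t → Hyp X :=
  fun i => allVoters A k S [] (r i)

/-- The fraction of the voters `V` that err on the example `z = (x, y)`. -/
def avgErr {X : Type*} {t : ℕ} (V : Fin t → Hyp X) (z : X × Label) : ℝ :=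
  (∑ i, if V i z.1 ≠ z.2 then 1 else 0) / (t : ℝ)

/-- The probability over `z ∼ D` that at least an `α`-fraction of the voters errs on `z`. -/
def voteError {X : Type*} [MeasurableSpace X] (D : Measure (X × Label)) (α : ℝ) {t : ℕ}
    (V : Fin t → Hyp X) : ℝ :=
  D.real {z | α ≤ avgErr V z}

end AgnosticVoting

end

/-!
If a `10 / 243` fraction of all voters errs on an example, then so does a `10 / 243` fraction of the
voters of some block `i`, and a `1 / 243` fraction of the voters belongs to other blocks `j` and
errs there too. The voters of the block `j` are empirical risk minimizers whose training sets all
contain the tail of the block `j`, and this tail is independent of the region `R` where the block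
`i` errs. So a relative deviation bound, localized to `R`, controls the errors of these voters in
`R` with a complexity term proportional to `n * D R` instead of a logarithm of `n`. The recursive
call bounds `n * D R` itself, and summing over all pairs of blocks closes the recursion without a
logarithmic factor.

By Hoeffding's inequality, a `11 / 243` fraction of the drawn voters rarely errs on an example
outside the region where a `10 / 243` fraction of all voters errs, and Chernoff's bound compares
the empirical error of a nearly optimal classifier with its true error.
-/

namespace AgnosticVoting

open scoped ENNReal NNReal

instance {M : Type*} [Monoid M] [MeasurableSpace M] [MeasurableSingletonClass M] :
    MeasurableSingletonClass Mˣ where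
  measurableSet_singleton u :=
    ⟨{(u : M)}, measurableSet_singleton _, by ext v; simp [Units.ext_iff]⟩

section ProductMeasure

variable {ι κ Ω Z : Type*} [MeasurableSpace Ω] [MeasurableSpace Z]

theorem lintegral_pi_prod_eq_prod_lintegral [Fintype ι] (μ : ι → Measure Z)
    [∀ i, IsProbabilityMeasure (μ i)] {f : ι → Z → ℝ≥0∞} (hf : ∀ i, Measurable (f i)) :
    ∫⁻ s, ∏ i, f i (s i) ∂Measure.pi μ = ∏ i, ∫⁻ z, f i z ∂μ i := by
  have hindep : iIndepFun (fun (i : ι) (s : ι → Z) => f i (s i)) (Measure.pi μ) :=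
    iIndepFun_pi fun i => (hf i).aemeasurable
  rw [lintegral_prod_eq_prod_lintegral_of_indepFun Finset.univ _ hindep
    fun i => (hf i).comp (measurable_pi_apply i)]
  exact Finset.prod_congr rfl fun i _ => (measurePreserving_eval μ i).lintegral_comp (hf i)

theorem prod_measure_le_of_forall_section_le {μ : Measure Ω} [IsProbabilityMeasure μ]
    {ν : Measure Z} [SFinite ν] {E : Set (Ω × Z)} (hE : MeasurableSet E) {ε : ℝ≥0∞}
    (h : ∀ ω, ν {z | (ω, z) ∈ E} ≤ ε) : μ.prod ν E ≤ ε := by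
  rw [Measure.prod_apply hE]
  calc _ ≤ ∫⁻ _, ε ∂μ := lintegral_mono h
    _ = ε := by simp

/-- Fubini and Markov's inequality. -/
theorem measure_setOf_div_lt_section_le {μ : Measure Ω} [IsProbabilityMeasure μ]
    {D : Measure Z} [IsProbabilityMeasure D] {F : Set (Ω × Z)} (hF : MeasurableSet F) {η δ : ℝ}
    (hη : 0 < η) (hδ : 0 < δ) (h : ∀ z, μ {ω | (ω, z) ∈ F} ≤ ENNReal.ofReal η) :
    μ {ω | η / δ < D.real {z | (ω, z) ∈ F}} ≤ ENNReal.ofReal δ := by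
  have hmean : ∫⁻ ω, D {z | (ω, z) ∈ F} ∂μ ≤ ENNReal.ofReal η :=
    calc ∫⁻ ω, D {z | (ω, z) ∈ F} ∂μ = ∫⁻ z, μ {ω | (ω, z) ∈ F} ∂D := by
          exact (Measure.prod_apply hF).symm.trans (Measure.prod_apply_symm hF)
      _ ≤ ∫⁻ _, ENNReal.ofReal η ∂D := lintegral_mono h
      _ = ENNReal.ofReal η := by simp
  have hsub : {ω | η / δ < D.real {z | (ω, z) ∈ F}} ⊆
      {ω | ENNReal.ofReal (η / δ) ≤ D {z | (ω, z) ∈ F}} := fun ω hω => by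
    rw [Set.mem_ofPred_eq, ← ofReal_measureReal]
    exact ENNReal.ofReal_le_ofReal (le_of_lt hω)
  calc μ {ω | η / δ < D.real {z | (ω, z) ∈ F}}
      ≤ (∫⁻ ω, D {z | (ω, z) ∈ F} ∂μ) / ENNReal.ofReal (η / δ) :=
        (measure_mono hsub).trans (meas_ge_le_lintegral_div
          (measurable_measure_prodMk_left hF).aemeasurable
          (ENNReal.ofReal_pos.2 (by positivity)).ne' ENNReal.ofReal_ne_top)
    _ ≤ ENNReal.ofReal η / ENNReal.ofReal (η / δ) := by gcongr
    _ = ENNReal.ofReal δ := by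
        rw [← ENNReal.ofReal_div_of_pos (by positivity), div_div_cancel₀ hη.ne']

theorem measure_ofReal_exp_add_log_le {μ : Measure Ω} {f : Ω → ℝ≥0∞} (hf : Measurable f)
    {B δ : ℝ} (hδ : 0 < δ) (h : ∫⁻ ω, f ω ∂μ ≤ ENNReal.ofReal (Real.exp B)) :
    μ {ω | ENNReal.ofReal (Real.exp (B + Real.log (1 / δ))) ≤ f ω} ≤ ENNReal.ofReal δ :=
  calc _ ≤ (∫⁻ ω, f ω ∂μ) / ENNReal.ofReal (Real.exp (B + Real.log (1 / δ))) :=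
        meas_ge_le_lintegral_div hf.aemeasurable (ENNReal.ofReal_pos.2 (Real.exp_pos _)).ne'
          ENNReal.ofReal_ne_top
    _ ≤ ENNReal.ofReal (Real.exp B) / ENNReal.ofReal (Real.exp (B + Real.log (1 / δ))) := by gcongr
    _ = ENNReal.ofReal δ := by
        rw [← ENNReal.ofReal_div_of_pos (Real.exp_pos _), ← Real.exp_sub, sub_add_cancel_left,
          one_div, Real.log_inv, neg_neg, Real.exp_log hδ]

theorem measurable_extend_prod {f : ι → κ} (hf : f.Injective) :
    Measurable fun p : (κ → Z) × (ι → Z) => Function.extend f p.2 p.1 := by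
  refine measurable_pi_iff.2 fun i => ?_
  by_cases hi : ∃ a, f a = i
  · obtain ⟨a, rfl⟩ := hi
    simp only [hf.extend_apply]
    fun_prop
  · simp only [Function.extend_apply' _ _ _ hi]
    fun_prop

variable [Fintype ι] [Fintype κ]

theorem measurePreserving_extend (μ : κ → Measure Z) [∀ i, IsProbabilityMeasure (μ i)]
    {f : ι → κ} (hf : f.Injective) :
    MeasurePreserving (fun p : (κ → Z) × (ι → Z) => Function.extend f p.2 p.1)
      ((Measure.pi μ).prod (Measure.pi fun a => μ (f a))) (Measure.pi μ) := by
  classical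
  have hm := measurable_extend_prod (Z := Z) hf
  refine ⟨hm, (Measure.pi_eq fun B hB => ?_).symm⟩
  have hpre : (fun p : (κ → Z) × (ι → Z) => Function.extend f p.2 p.1) ⁻¹' Set.univ.pi B =
      (Set.univ.pi fun i => if ∃ a, f a = i then Set.univ else B i) ×ˢ
        (Set.univ.pi fun a => B (f a)) := by
    ext ⟨s, u⟩
    simp only [Set.mem_preimage, Set.mem_pi, Set.mem_univ, true_imp_iff, Set.mem_prod]
    refine ⟨fun h => ⟨fun i => ?_, fun a => hf.extend_apply u s a ▸ h (f a)⟩, fun ⟨h₁, h₂⟩ i => ?_⟩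
    · split_ifs with hi
      exacts [trivial, Function.extend_apply' u s i hi ▸ h i]
    · by_cases hi : ∃ a, f a = i
      · obtain ⟨a, rfl⟩ := hi
        exact (hf.extend_apply u s a).symm ▸ h₂ a
      · rw [Function.extend_apply' u s i hi]
        simpa only [hi, if_false] using h₁ i
  have hrange : ∏ a, μ (f a) (B (f a)) = ∏ i, if ∃ a, f a = i then μ i (B i) else 1 := by
    rw [← Finset.prod_filter]
    exact (Finset.prod_map Finset.univ ⟨f, hf⟩ fun i => μ i (B i)).symm.trans
      (Finset.prod_congr (by ext i; simp) fun _ _ => rfl)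
  rw [Measure.map_apply hm (MeasurableSet.univ_pi hB), hpre, Measure.prod_prod, Measure.pi_pi,
    Measure.pi_pi, hrange, ← Finset.prod_mul_distrib]
  refine Finset.prod_congr rfl fun i _ => ?_
  split_ifs <;> simp

theorem pi_le_of_forall_extend_le (μ : κ → Measure Z) [∀ i, IsProbabilityMeasure (μ i)]
    {f : ι → κ} (hf : f.Injective) {E : Set (κ → Z)} (hE : MeasurableSet E) {ε : ℝ≥0∞}
    (h : ∀ s, (Measure.pi fun a => μ (f a)) {u | Function.extend f u s ∈ E} ≤ ε) :
    Measure.pi μ E ≤ ε := by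
  have hp := measurePreserving_extend μ hf
  rw [← hp.measure_preimage hE.nullMeasurableSet]
  exact prod_measure_le_of_forall_section_le (hp.measurable hE) h

end ProductMeasure

section SauerShelah

variable {X : Type*} {H : Set (Hyp X)} {F : Finset X} {d : ℕ}

theorem HasVCDim.card_le (hd : HasVCDim H d) (hF : Shatters H F) : F.card ≤ d :=
  hd.2 ⟨F, rfl, hF⟩

theorem HasVCDim.nonempty (hd : HasVCDim H d) : H.Nonempty := by
  obtain ⟨F, -, hF⟩ := hd.1
  obtain ⟨h, hh, -⟩ := hF 1
  exact ⟨h, hh⟩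

theorem label_eq_of_eq_one_iff {u v : Label} (h : u = 1 ↔ v = 1) : u = v := by
  rcases Int.units_eq_one_or u with rfl | rfl <;>
    rcases Int.units_eq_one_or v with rfl | rfl <;> simp_all

open Classical in
/-- The restrictions to `F` of the members of `H`, each encoded by the set of the points of `F`
with label `1`. -/
noncomputable def traces (H : Set (Hyp X)) (F : Finset X) : Finset (Finset X) :=
  F.powerset.filter fun t => ∃ h ∈ H, ∀ a ∈ F, a ∈ t ↔ h a = 1

theorem mem_traces {t : Finset X} :
    t ∈ traces H F ↔ t ⊆ F ∧ ∃ h ∈ H, ∀ a ∈ F, a ∈ t ↔ h a = 1 := by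
  simp [traces]

theorem subset_of_mem_shatterer_traces [DecidableEq X] {s : Finset X}
    (hs : s ∈ (traces H F).shatterer) : s ⊆ F := by
  obtain ⟨u, hu, hsu⟩ := Finset.mem_shatterer.1 hs (Finset.Subset.refl s)
  exact (Finset.inter_eq_left.1 hsu).trans (mem_traces.1 hu).1

theorem shatters_of_mem_shatterer_traces [DecidableEq X] {s : Finset X}
    (hs : s ∈ (traces H F).shatterer) : Shatters H s := by
  intro g
  obtain ⟨u, hu, hsu⟩ := Finset.mem_shatterer.1 hs (Finset.filter_subset (fun a => g a = 1) s)
  obtain ⟨-, h, hh, hut⟩ := mem_traces.1 hu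
  refine ⟨h, hh, fun a ha => label_eq_of_eq_one_iff ?_⟩
  rw [← hut a (subset_of_mem_shatterer_traces hs ha)]
  simpa [ha] using Finset.ext_iff.1 hsu a

theorem pow_mul_card_traces_le (hd : ∀ s : Finset X, Shatters H s → s.card ≤ d) (F : Finset X)
    {x : ℝ≥0} (hx : x ≤ 1) : x ^ d * (traces H F).card ≤ (1 + x) ^ F.card := by
  classical
  calc x ^ d * (traces H F).card
      ≤ x ^ d * (traces H F).shatterer.card :=
        mul_le_mul_right (Nat.cast_le.2 (traces H F).card_le_card_shatterer) _
    _ = ∑ _s ∈ (traces H F).shatterer, x ^ d := by rw [Finset.sum_const, nsmul_eq_mul, mul_comm]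
    _ ≤ ∑ s ∈ (traces H F).shatterer, x ^ s.card * 1 ^ (F.card - s.card) :=
        Finset.sum_le_sum fun s hs => by
          rw [one_pow, mul_one]
          exact pow_le_pow_of_le_one zero_le hx (hd s (shatters_of_mem_shatterer_traces hs))
    _ ≤ ∑ s ∈ F.powerset, x ^ s.card * 1 ^ (F.card - s.card) :=
        Finset.sum_le_sum_of_subset fun s hs =>
          Finset.mem_powerset.2 (subset_of_mem_shatterer_traces hs)
    _ = (1 + x) ^ F.card := by rw [Finset.sum_pow_mul_eq_add_pow, add_comm]

/-- The Sauer–Shelah lemma in the form of a weighted count. -/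
theorem exists_finset_eqOn (hd : ∀ s : Finset X, Shatters H s → s.card ≤ d) (F : Finset X)
    {x : ℝ≥0} (hx : x ≤ 1) :
    ∃ G : Finset (Hyp X), x ^ d * G.card ≤ (1 + x) ^ F.card ∧
      ∀ h ∈ H, ∃ g ∈ G, ∀ a ∈ F, g a = h a := by
  classical
  refine ⟨(traces H F).image fun t a => if a ∈ t then 1 else -1, ?_, fun h hh => ?_⟩
  · exact (mul_le_mul_right (Nat.cast_le.2 Finset.card_image_le) _).trans
      (pow_mul_card_traces_le hd F hx)
  · refine ⟨_, Finset.mem_image_of_mem _ (mem_traces.2 ⟨F.filter_subset fun a => h a = 1, h, hh,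
      fun a ha => by simp [ha]⟩), fun a ha => label_eq_of_eq_one_iff ?_⟩
    by_cases h1 : h a = 1 <;> simp [ha, h1]

end SauerShelah

section Errors

variable {X : Type*}

/-- The examples on which `h` errs. -/
def errSet (h : Hyp X) : Set (X × Label) := {z | h z.1 ≠ z.2}

/-- The number of the entries of `S` on which `h` errs. -/
def errCount (h : Hyp X) (S : List (X × Label)) : ℕ := S.countP fun z => h z.1 ≠ z.2

theorem errCount_le_of_sublist (h : Hyp X) {S T : List (X × Label)} (hST : S.Sublist T) :
    errCount h S ≤ errCount h T :=
  hST.countP_le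

theorem errCount_ofFn {n : ℕ} (h : Hyp X) (s : Fin n → X × Label) :
    errCount h (List.ofFn s) = ∑ i, if h (s i).1 ≠ (s i).2 then 1 else 0 := by
  induction n with
  | zero => simp [errCount]
  | succ n ih =>
    rw [List.ofFn_succ, errCount, List.countP_cons, Fin.sum_univ_succ, add_comm]
    exact congrArg₂ _ (by simp) (ih _)

theorem IsERM.errCount_le {H : Set (Hyp X)} {A : Learner X} (hA : IsERM H A)
    (S : List (X × Label)) {h : Hyp X} (hh : h ∈ H) : errCount (A S) S ≤ errCount h S := by
  rcases S.eq_nil_or_concat with rfl | ⟨_, _, hS⟩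
  · simp [errCount]
  have hpos : (0 : ℝ) < S.length := by
    rw [hS, List.length_concat]
    positivity
  have hle := (hA S).2 h hh
  rw [empError, empError, div_le_div_iff_of_pos_right hpos] at hle
  exact_mod_cast hle

variable {Ω : Type*} [MeasurableSpace X] [MeasurableSpace Ω] {V : Ω → Hyp X}

theorem measurableSet_setOf_mem_errSet (hV : Measurable fun p : Ω × X => V p.1 p.2)
    {g : Ω → X × Label} (hg : Measurable g) : MeasurableSet {ω | g ω ∈ errSet (V ω)} :=
  (measurableSet_eq_fun (hV.comp (measurable_id.prodMk hg.fst)) hg.snd).compl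

theorem measurableSet_prod_errSet (hV : Measurable fun p : Ω × X => V p.1 p.2) :
    MeasurableSet {p : Ω × (X × Label) | p.2 ∈ errSet (V p.1)} :=
  measurableSet_setOf_mem_errSet (V := fun p : Ω × (X × Label) => V p.1)
    (hV.comp (by fun_prop : Measurable fun q : (Ω × (X × Label)) × X => (q.1.1, q.2)))
    measurable_snd

theorem measurableSet_errSet {h : Hyp X} (hh : Measurable h) : MeasurableSet (errSet h) :=
  measurableSet_setOf_mem_errSet (V := fun _ => h) (hh.comp measurable_snd) measurable_id

end Errors

section Weight

variable {ι Z : Type*}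

open Classical in
/-- The function with value `a` on `B` and `1` off `B`; its product over a sample is the
exponential of a multiple of the number of sample points in `B`. -/
noncomputable def weight (a : ℝ≥0∞) (B : Set Z) (z : Z) : ℝ≥0∞ := if z ∈ B then a else 1

theorem weight_congr {a : ℝ≥0∞} {B B' : Set Z} {z : Z} (h : z ∈ B ↔ z ∈ B') :
    weight a B z = weight a B' z := by
  by_cases hz : z ∈ B
  · simp [weight, hz, h.1 hz]
  · simp [weight, hz, mt h.2 hz]

theorem weight_anti {a : ℝ≥0∞} (ha : a ≤ 1) {B B' : Set Z} (h : B ⊆ B') (z : Z) :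
    weight a B' z ≤ weight a B z := by
  by_cases hB : z ∈ B
  · simp [weight, hB, h hB]
  · by_cases hB' : z ∈ B' <;> simp [weight, hB, hB', ha]

open Classical in
theorem prod_weight [Fintype ι] (a : ℝ≥0∞) (B : Set Z) (s : ι → Z) :
    ∏ i, weight a B (s i) = a ^ (Finset.univ.filter fun i => s i ∈ B).card := by
  simp [weight, Finset.prod_ite]

theorem prod_weight_errSet {X : Type*} {n : ℕ} (a : ℝ≥0∞) (h : Hyp X) (s : Fin n → X × Label) :
    ∏ i, weight a (errSet h) (s i) = a ^ errCount h (List.ofFn s) := by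
  rw [errCount_ofFn, ← Finset.prod_pow_eq_pow_sum]
  refine Finset.prod_congr rfl fun i _ => ?_
  by_cases hi : h (s i).1 = (s i).2 <;> simp [weight, errSet, hi]

theorem measurable_weight_mem {Ω : Type*} [MeasurableSpace Ω] (a : ℝ≥0∞) {B : Ω → Set Z}
    {g : Ω → Z} (h : MeasurableSet {ω | g ω ∈ B ω}) : Measurable fun ω => weight a (B ω) (g ω) :=
  Measurable.ite h measurable_const measurable_const

variable [MeasurableSpace Z]

theorem measurable_weight (a : ℝ≥0∞) {B : Set Z} (hB : MeasurableSet B) :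
    Measurable (weight a B) :=
  measurable_weight_mem (B := fun _ => B) (g := id) a hB

theorem lintegral_weight_one_add (D : Measure Z) [IsProbabilityMeasure D] (c : ℝ≥0∞) {B : Set Z}
    (hB : MeasurableSet B) : ∫⁻ z, weight (1 + c) B z ∂D = 1 + c * D B := by
  have hind : weight (1 + c) B = fun z => 1 + B.indicator (fun _ => c) z := by
    ext z
    by_cases hz : z ∈ B <;> simp [weight, hz]
  rw [hind, lintegral_add_left measurable_const, lintegral_indicator_const hB]
  simp

theorem lintegral_prod_weight_one_add [Fintype ι] (D : Measure Z) [IsProbabilityMeasure D]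
    (c : ℝ≥0∞) {B : Set Z} (hB : MeasurableSet B) :
    ∫⁻ s, ∏ i, weight (1 + c) B (s i) ∂(Measure.pi fun _ : ι => D) =
      (1 + c * D B) ^ Fintype.card ι := by
  rw [lintegral_pi_prod_eq_prod_lintegral _ fun _ => measurable_weight _ hB,
    lintegral_weight_one_add D c hB, Finset.prod_const, Finset.card_univ]

theorem lintegral_prod_weight_mul_weight [Fintype ι] (D : Measure Z) [IsProbabilityMeasure D]
    (c : ℝ≥0∞) {B : Set Z} (hB : MeasurableSet B) :
    ∫⁻ w, ∏ i, weight (1 + c) B (w i).1 * weight (1 + c) B (w i).2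
      ∂(Measure.pi fun _ : ι => D.prod D) = (1 + c * D B) ^ (2 * Fintype.card ι) := by
  have hw := measurable_weight (1 + c) hB
  rw [lintegral_pi_prod_eq_prod_lintegral _
    (f := fun _ (z : Z × Z) => weight (1 + c) B z.1 * weight (1 + c) B z.2) fun _ => by fun_prop,
    lintegral_prod_mul hw.aemeasurable hw.aemeasurable, lintegral_weight_one_add D c hB, ← sq,
    Finset.prod_const, Finset.card_univ, pow_mul]

end Weight

section Symmetrization

variable {ι Z Q : Type*}

/-- Exchange the components of the pairs `w i` with `σ i = true`. -/
def swapPairs (σ : ι → Bool) (w : ι → Z × Z) : ι → Z × Z :=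
  fun i => if σ i then (w i).swap else w i

theorem weight_mul_weight_add_le {c : ℝ≥0∞} (hc : c ≤ 1) (B : Set Z) (a b : Z) :
    weight (1 + c) B b * weight (1 - c) B a + weight (1 + c) B a * weight (1 - c) B b ≤ 2 := by
  have hsum : 1 + c + (1 - c) = 2 := by
    rw [add_assoc, add_tsub_cancel_of_le hc, one_add_one_eq_two]
  have hmul : (1 + c) * (1 - c) ≤ 1 :=
    calc (1 + c) * (1 - c) = (1 - c) + c * (1 - c) := by rw [add_mul, one_mul]
      _ ≤ (1 - c) + c * 1 := by gcongr; exact tsub_le_self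
      _ = 1 := by rw [mul_one, tsub_add_cancel_of_le hc]
  by_cases ha : a ∈ B <;> by_cases hb : b ∈ B <;>
    simp only [weight, ha, hb, if_true, if_false, mul_one, one_mul]
  · exact (add_le_add hmul hmul).trans_eq one_add_one_eq_two
  · exact (add_comm _ _).trans_le hsum.le
  · exact hsum.le
  · exact one_add_one_eq_two.le

variable [Fintype ι]

/-- The exponential weight of a double sample `w`, for the excess of the number of its second
components in `B` over the number of its first components in `B`. -/
noncomputable def pairWeight (c : ℝ≥0∞) (B : Set Z) (w : ι → Z × Z) : ℝ≥0∞ :=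
  ∏ i, weight (1 + c) B (w i).2 * weight (1 - c) B (w i).1

theorem pairWeight_congr {c : ℝ≥0∞} {B B' : Set Z} {w : ι → Z × Z}
    (h : ∀ i, ((w i).1 ∈ B ↔ (w i).1 ∈ B') ∧ ((w i).2 ∈ B ↔ (w i).2 ∈ B')) :
    pairWeight c B w = pairWeight c B' w :=
  Finset.prod_congr rfl fun i _ => by rw [weight_congr (h i).1, weight_congr (h i).2]

section Swap

variable [DecidableEq ι]

theorem sum_pairWeight_swapPairs_le {c : ℝ≥0∞} (hc : c ≤ 1) (B : Set Z) (w : ι → Z × Z) :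
    ∑ σ : ι → Bool, pairWeight c B (swapPairs σ w) ≤ 2 ^ Fintype.card ι := by
  let f : ι → Bool → ℝ≥0∞ := fun i b =>
    if b then weight (1 + c) B (w i).1 * weight (1 - c) B (w i).2
    else weight (1 + c) B (w i).2 * weight (1 - c) B (w i).1
  have hf (σ : ι → Bool) : pairWeight c B (swapPairs σ w) = ∏ i, f i (σ i) :=
    Finset.prod_congr rfl fun i _ => by by_cases hσ : σ i <;> simp [swapPairs, f, hσ]
  calc ∑ σ : ι → Bool, pairWeight c B (swapPairs σ w) = ∏ i, ∑ b, f i b := by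
        simp_rw [hf, Fintype.prod_sum]
    _ ≤ ∏ _i : ι, 2 := Finset.prod_le_prod' fun i _ => by
        rw [Fintype.sum_bool, add_comm]
        exact weight_mul_weight_add_le hc B _ _
    _ = 2 ^ Fintype.card ι := by simp

theorem sum_iSup_pairWeight_swapPairs_le {c : ℝ≥0∞} (hc : c ≤ 1) (B : Q → (ι → Z) → Set Z)
    (w : ι → Z × Z) (G : Finset (Set Z))
    (hG : ∀ q s, ∃ g ∈ G, ∀ i, ((w i).1 ∈ B q s ↔ (w i).1 ∈ g) ∧ ((w i).2 ∈ B q s ↔ (w i).2 ∈ g)) :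
    ∑ σ : ι → Bool, ⨆ q, pairWeight c (B q fun i => (swapPairs σ w i).1) (swapPairs σ w) ≤
      2 ^ Fintype.card ι * G.card := by
  have hcover (σ : ι → Bool) (q : Q) :
      pairWeight c (B q fun i => (swapPairs σ w i).1) (swapPairs σ w) ≤
        ∑ g ∈ G, pairWeight c g (swapPairs σ w) := by
    obtain ⟨g, hg, hBg⟩ := hG q fun i => (swapPairs σ w i).1
    refine (pairWeight_congr fun i => ?_).trans_le
      (Finset.single_le_sum (f := fun g => pairWeight c g (swapPairs σ w)) (fun _ _ => zero_le) hg)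
    by_cases hσ : σ i <;> simp only [swapPairs, hσ]
    exacts [(hBg i).symm, hBg i]
  calc _ ≤ ∑ σ : ι → Bool, ∑ g ∈ G, pairWeight c g (swapPairs σ w) :=
        Finset.sum_le_sum fun σ _ => iSup_le (hcover σ)
    _ = ∑ g ∈ G, ∑ σ : ι → Bool, pairWeight c g (swapPairs σ w) := Finset.sum_comm
    _ ≤ ∑ _g ∈ G, 2 ^ Fintype.card ι :=
        Finset.sum_le_sum fun g _ => sum_pairWeight_swapPairs_le hc g w
    _ = 2 ^ Fintype.card ι * G.card := by rw [Finset.sum_const, nsmul_eq_mul, mul_comm]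

end Swap

variable [MeasurableSpace Z]

theorem measurePreserving_swapPairs (D : Measure Z) [SigmaFinite D] (σ : ι → Bool) :
    MeasurePreserving (swapPairs σ : (ι → Z × Z) → ι → Z × Z)
      (Measure.pi fun _ => D.prod D) (Measure.pi fun _ => D.prod D) := by
  refine measurePreserving_pi (fun _ => D.prod D) (fun _ => D.prod D)
    (f := fun i z => if σ i then z.swap else z) fun i => ?_
  by_cases h : σ i
  · simpa [h] using Measure.measurePreserving_swap (μ := D) (ν := D)
  · simp only [h]
    exact MeasurePreserving.id (D.prod D)

theorem two_pow_mul_lintegral_eq_lintegral_sum_swapPairs [DecidableEq ι] (D : Measure Z)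
    [SigmaFinite D] {Φ : (ι → Z × Z) → ℝ≥0∞} (hΦ : Measurable Φ) :
    2 ^ Fintype.card ι * ∫⁻ w, Φ w ∂(Measure.pi fun _ => D.prod D) =
      ∫⁻ w, ∑ σ : ι → Bool, Φ (swapPairs σ w) ∂(Measure.pi fun _ => D.prod D) := by
  rw [lintegral_finsetSum (f := fun (σ : ι → Bool) w => Φ (swapPairs σ w)) _
    fun σ _ => hΦ.comp (measurePreserving_swapPairs D σ).measurable]
  simp_rw [(measurePreserving_swapPairs D _).lintegral_comp hΦ]
  simp

theorem lintegral_pi_prod_eq_lintegral_lintegral (D : Measure Z) [SigmaFinite D]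
    {Φ : (ι → Z × Z) → ℝ≥0∞} (hΦ : Measurable Φ) :
    ∫⁻ w, Φ w ∂(Measure.pi fun _ => D.prod D) =
      ∫⁻ s, ∫⁻ s', Φ (fun i => (s i, s' i)) ∂(Measure.pi fun _ => D) ∂(Measure.pi fun _ => D) := by
  have hm : Measurable fun p : (ι → Z) × (ι → Z) => Φ fun i => (p.1 i, p.2 i) :=
    hΦ.comp (by fun_prop)
  rw [← lintegral_prod _ hm.aemeasurable,
    ← (measurePreserving_arrowProdEquivProdArrow Z Z ι (fun _ => D) fun _ => D).lintegral_comp hm]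
  rfl

variable {D : Measure Z} [IsProbabilityMeasure D] {B : Q → (ι → Z) → Set Z}

theorem measurable_pairWeight_fst (c : ℝ≥0∞) {B : (ι → Z) → Set Z}
    (hB : MeasurableSet {p : (ι → Z) × Z | p.2 ∈ B p.1}) :
    Measurable fun w : ι → Z × Z => pairWeight c (B fun i => (w i).1) w := by
  have hmem {g : (ι → Z × Z) → Z} (hg : Measurable g) :
      MeasurableSet {w | g w ∈ B fun i => (w i).1} :=
    (by fun_prop : Measurable fun w : ι → Z × Z => ((fun i => (w i).1), g w)) hB
  exact Finset.measurable_fun_prod _ fun i _ =>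
    (measurable_weight_mem _ (hmem (by fun_prop))).mul
      (measurable_weight_mem _ (hmem (by fun_prop)))

theorem lintegral_pairWeight_ghost (c : ℝ≥0∞) {B : Set Z} (hB : MeasurableSet B) (s : ι → Z) :
    ∫⁻ s', pairWeight c B (fun i => (s i, s' i)) ∂(Measure.pi fun _ => D) =
      (1 + c * D B) ^ Fintype.card ι * ∏ i, weight (1 - c) B (s i) := by
  simp only [pairWeight, Finset.prod_mul_distrib]
  have hm := measurable_weight (1 + c) hB
  rw [lintegral_mul_const _ (by fun_prop), lintegral_prod_weight_one_add D c hB]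

/-- The expectation over the ghost sample is taken inside the supremum, and the random exchanges
of the pairs reduce the supremum to a finite sum for each fixed double sample. -/
theorem lintegral_iSup_le_lintegral_card [Countable Q] {c : ℝ≥0∞} (hc : c ≤ 1)
    (hB : ∀ q, MeasurableSet {p : (ι → Z) × Z | p.2 ∈ B q p.1}) (K : (ι → Z × Z) → ℝ≥0∞)
    (hK : ∀ w, ∃ G : Finset (Set Z), G.card ≤ K w ∧ ∀ q s, ∃ g ∈ G, ∀ i,
      ((w i).1 ∈ B q s ↔ (w i).1 ∈ g) ∧ ((w i).2 ∈ B q s ↔ (w i).2 ∈ g)) :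
    ∫⁻ s, ⨆ q, (1 + c * D (B q s)) ^ Fintype.card ι * ∏ i, weight (1 - c) (B q s) (s i)
        ∂(Measure.pi fun _ => D) ≤
      ∫⁻ w, K w ∂(Measure.pi fun _ : ι => D.prod D) := by
  classical
  let Φ : (ι → Z × Z) → ℝ≥0∞ := fun w => ⨆ q, pairWeight c (B q fun i => (w i).1) w
  have hΦ : Measurable Φ := Measurable.iSup fun q => measurable_pairWeight_fst c (hB q)
  have hBs (q : Q) (s : ι → Z) : MeasurableSet (B q s) := measurable_prodMk_left (hB q)
  have h0 : (2 : ℝ≥0∞) ^ Fintype.card ι ≠ 0 := by positivity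
  have htop : (2 : ℝ≥0∞) ^ Fintype.card ι ≠ ⊤ := ENNReal.pow_ne_top (by simp)
  calc _ ≤ ∫⁻ s, ∫⁻ s', Φ (fun i => (s i, s' i)) ∂(Measure.pi fun _ => D)
          ∂(Measure.pi fun _ => D) := lintegral_mono fun s => iSup_le fun q => by
        rw [← lintegral_pairWeight_ghost c (hBs q s)]
        exact lintegral_mono fun s' =>
          le_iSup (fun q => pairWeight c (B q s) fun i => (s i, s' i)) q
    _ = ∫⁻ w, Φ w ∂(Measure.pi fun _ => D.prod D) :=
        (lintegral_pi_prod_eq_lintegral_lintegral D hΦ).symm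
    _ ≤ ∫⁻ w, K w ∂(Measure.pi fun _ => D.prod D) := by
        rw [← ENNReal.mul_le_mul_iff_right h0 htop,
          two_pow_mul_lintegral_eq_lintegral_sum_swapPairs D hΦ, ← lintegral_const_mul' _ _ htop]
        refine lintegral_mono fun w => ?_
        obtain ⟨G, hGK, hG⟩ := hK w
        exact (sum_iSup_pairWeight_swapPairs_le hc B w G hG).trans (by gcongr)

end Symmetrization

section UniformDeviation

variable {ι X Q : Type*} [Fintype ι] {H : Set (Hyp X)} {d : ℕ}

theorem exists_finset_inter_errSet (hd : ∀ F : Finset X, Shatters H F → F.card ≤ d) {x : ℝ≥0}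
    (hx : x ≤ 1) (R : Set (X × Label)) (w : ι → (X × Label) × (X × Label)) :
    ∃ G : Finset (Set (X × Label)),
      x ^ d * (G.card : ℝ≥0∞) ≤ ∏ i, weight (1 + x) R (w i).1 * weight (1 + x) R (w i).2 ∧
        ∀ h ∈ H, ∃ g ∈ G, ∀ i, ((w i).1 ∈ R ∩ errSet h ↔ (w i).1 ∈ g) ∧
          ((w i).2 ∈ R ∩ errSet h ↔ (w i).2 ∈ g) := by
  classical
  let F₁ : Finset X := (Finset.univ.filter fun i => (w i).1 ∈ R).image fun i => (w i).1.1
  let F₂ : Finset X := (Finset.univ.filter fun i => (w i).2 ∈ R).image fun i => (w i).2.1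
  obtain ⟨G, hGcard, hG⟩ := exists_finset_eqOn hd (F₁ ∪ F₂) hx
  have hmem {g h : Hyp X} (hgh : ∀ a ∈ F₁ ∪ F₂, g a = h a) {z : X × Label}
      (hz : z ∈ R → z.1 ∈ F₁ ∪ F₂) : z ∈ R ∩ errSet h ↔ z ∈ R ∩ errSet g := by
    by_cases hR : z ∈ R
    · simp [errSet, hR, hgh _ (hz hR)]
    · simp [hR]
  refine ⟨G.image fun g => R ∩ errSet g, ?_, fun h hh => ?_⟩
  · calc x ^ d * ((G.image fun g => R ∩ errSet g).card : ℝ≥0∞)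
        ≤ x ^ d * (G.card : ℝ≥0∞) := mul_le_mul_right (Nat.cast_le.2 Finset.card_image_le) _
      _ ≤ (1 + x) ^ (F₁ ∪ F₂).card := by exact_mod_cast hGcard
      _ ≤ (1 + x) ^ ((Finset.univ.filter fun i => (w i).1 ∈ R).card +
            (Finset.univ.filter fun i => (w i).2 ∈ R).card) :=
          pow_le_pow_right₀ le_self_add ((Finset.card_union_le _ _).trans
            (add_le_add Finset.card_image_le Finset.card_image_le))
      _ = ∏ i, weight (1 + x) R (w i).1 * weight (1 + x) R (w i).2 := by
          rw [Finset.prod_mul_distrib, prod_weight _ R fun i => (w i).1,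
            prod_weight _ R fun i => (w i).2, pow_add]
  · obtain ⟨g, hg, hgh⟩ := hG h hh
    refine ⟨R ∩ errSet g, Finset.mem_image_of_mem _ hg, fun i => ⟨hmem hgh fun hi => ?_,
      hmem hgh fun hi => ?_⟩⟩
    · exact Finset.mem_union_left _ (Finset.mem_image.2 ⟨i, by simpa using hi, rfl⟩)
    · exact Finset.mem_union_right _ (Finset.mem_image.2 ⟨i, by simpa using hi, rfl⟩)

variable [MeasurableSpace X]

theorem lintegral_iSup_inter_errSet_le [Countable Q]
    (hd : ∀ F : Finset X, Shatters H F → F.card ≤ d) (D : Measure (X × Label))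
    [IsProbabilityMeasure D] {c : ℝ≥0∞} (hc : c ≤ 1) {R : Set (X × Label)} (hR : MeasurableSet R)
    {x : ℝ≥0} (hx0 : x ≠ 0) (hx : x ≤ 1) (V : Q → (ι → X × Label) → Hyp X)
    (hVH : ∀ q s, V q s ∈ H)
    (hV : ∀ q, Measurable fun p : (ι → X × Label) × X => V q p.1 p.2) :
    ∫⁻ s, ⨆ q, (1 + c * D (R ∩ errSet (V q s))) ^ Fintype.card ι *
        ∏ i, weight (1 - c) (R ∩ errSet (V q s)) (s i) ∂(Measure.pi fun _ => D) ≤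
      ((x : ℝ≥0∞) ^ d)⁻¹ * (1 + x * D R) ^ (2 * Fintype.card ι) := by
  have hpow0 : (x : ℝ≥0∞) ^ d ≠ 0 := pow_ne_zero _ (ENNReal.coe_ne_zero.2 hx0)
  have hpowtop : (x : ℝ≥0∞) ^ d ≠ ⊤ := ENNReal.pow_ne_top ENNReal.coe_ne_top
  rw [← lintegral_prod_weight_mul_weight D _ hR,
    ← lintegral_const_mul' _ _ (ENNReal.inv_ne_top.2 hpow0)]
  refine lintegral_iSup_le_lintegral_card (B := fun q s => R ∩ errSet (V q s)) hc
    (fun q => (measurable_snd hR).inter (measurableSet_prod_errSet (hV q))) _ fun w => ?_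
  obtain ⟨G, hGcard, hG⟩ := exists_finset_inter_errSet hd hx R w
  exact ⟨G, (ENNReal.mul_le_iff_le_inv hpow0 hpowtop).1 hGcard, fun q s => hG _ (hVH q s)⟩

theorem measurable_iSup_weight [Countable Q] (D : Measure (X × Label)) [SFinite D] (c : ℝ≥0∞)
    (n : ℕ) {R : Set (X × Label)} (hR : MeasurableSet R) {V : Q → (ι → X × Label) → Hyp X}
    (hV : ∀ q, Measurable fun p : (ι → X × Label) × X => V q p.1 p.2) :
    Measurable fun s => ⨆ q, (1 + c * D (R ∩ errSet (V q s))) ^ n *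
      ∏ i, weight (1 - c) (R ∩ errSet (V q s)) (s i) := by
  refine Measurable.iSup fun q => ?_
  have hD : Measurable fun s => D (R ∩ errSet (V q s)) := measurable_measure_prodMk_left
    ((measurable_snd hR).inter (measurableSet_prod_errSet (hV q)))
  exact (((hD.const_mul _).const_add 1).pow_const n).mul <| Finset.measurable_fun_prod _ fun i _ =>
    measurable_weight_mem _ ((measurable_pi_apply i hR).inter
      (measurableSet_setOf_mem_errSet (hV q) (measurable_pi_apply i)))

theorem exp_div_three_le {p : ℝ} (h0 : 0 ≤ p) (h1 : p ≤ 1) : Real.exp (p / 3) ≤ 1 + p / 2 := by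
  have hpos : 0 < 1 + p / 2 := by positivity
  rw [← Real.le_log_iff_exp_le hpos]
  refine le_trans ?_ (Real.one_sub_inv_le_log_of_pos hpos)
  rw [le_sub_iff_add_le, ← le_sub_iff_add_le', inv_eq_one_div, div_le_iff₀ hpos]
  nlinarith

theorem ofReal_exp_div_three_le (D : Measure (X × Label)) [IsProbabilityMeasure D]
    (B : Set (X × Label)) : ENNReal.ofReal (Real.exp (D.real B / 3)) ≤ 1 + 2⁻¹ * D B :=
  calc ENNReal.ofReal (Real.exp (D.real B / 3)) ≤ ENNReal.ofReal (1 + D.real B / 2) :=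
        ENNReal.ofReal_le_ofReal (exp_div_three_le measureReal_nonneg measureReal_le_one)
    _ = 1 + 2⁻¹ * D B := by
        rw [ENNReal.ofReal_add zero_le_one (by positivity), ENNReal.ofReal_one,
          ENNReal.ofReal_div_of_pos two_pos, ofReal_measureReal, ENNReal.ofReal_ofNat,
          ENNReal.div_eq_inv_mul]

theorem ofReal_exp_neg_one_le : ENNReal.ofReal (Real.exp (-1)) ≤ 2⁻¹ := by
  rw [Real.exp_neg, ENNReal.ofReal_inv_of_pos (Real.exp_pos 1), ENNReal.inv_le_inv,
    ← ENNReal.ofReal_ofNat 2]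
  exact ENNReal.ofReal_le_ofReal (by linarith [Real.add_one_le_exp 1])

theorem ofReal_exp_le_weight {n : ℕ} (D : Measure (X × Label)) [IsProbabilityMeasure D]
    (R : Set (X × Label)) (h : Hyp X) (s : Fin n → X × Label) :
    ENNReal.ofReal (Real.exp (n * D.real (R ∩ errSet h) / 3 - errCount h (List.ofFn s))) ≤
      (1 + 2⁻¹ * D (R ∩ errSet h)) ^ n * ∏ i, weight (1 - 2⁻¹) (R ∩ errSet h) (s i) :=
  calc ENNReal.ofReal (Real.exp (n * D.real (R ∩ errSet h) / 3 - errCount h (List.ofFn s)))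
      = ENNReal.ofReal (Real.exp (D.real (R ∩ errSet h) / 3)) ^ n *
          ENNReal.ofReal (Real.exp (-1)) ^ errCount h (List.ofFn s) := by
        rw [← ENNReal.ofReal_pow (Real.exp_pos _).le, ← ENNReal.ofReal_pow (Real.exp_pos _).le,
          ← ENNReal.ofReal_mul (by positivity), ← Real.exp_nat_mul, ← Real.exp_nat_mul,
          ← Real.exp_add, mul_neg_one, mul_div_assoc, sub_eq_add_neg]
    _ ≤ (1 + 2⁻¹ * D (R ∩ errSet h)) ^ n * 2⁻¹ ^ errCount h (List.ofFn s) := by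
        gcongr
        exacts [ofReal_exp_div_three_le D _, ofReal_exp_neg_one_le]
    _ ≤ (1 + 2⁻¹ * D (R ∩ errSet h)) ^ n * ∏ i, weight (1 - 2⁻¹) (R ∩ errSet h) (s i) := by
        rw [ENNReal.one_sub_inv_two, ← prod_weight_errSet]
        gcongr with i
        exact weight_anti (by simp) Set.inter_subset_right _

theorem inv_pow_mul_one_add_pow_le_exp (D : Measure (X × Label)) [IsFiniteMeasure D]
    (R : Set (X × Label)) {x : ℝ} (hx : 0 < x) (d n : ℕ) :
    (ENNReal.ofReal x ^ d)⁻¹ * (1 + ENNReal.ofReal x * D R) ^ (2 * n) ≤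
      ENNReal.ofReal (Real.exp (d * Real.log (1 / x) + 2 * n * x * D.real R)) := by
  rw [← ofReal_measureReal (μ := D) (s := R), ← ENNReal.ofReal_one, ← ENNReal.ofReal_mul hx.le,
    ← ENNReal.ofReal_add zero_le_one (by positivity), ← ENNReal.ofReal_pow hx.le,
    ← ENNReal.ofReal_pow (by positivity), ← ENNReal.ofReal_inv_of_pos (by positivity),
    ← ENNReal.ofReal_mul (by positivity)]
  refine ENNReal.ofReal_le_ofReal ?_
  rw [Real.exp_add, Real.exp_nat_mul, Real.exp_log (by positivity), one_div, inv_pow]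
  gcongr
  calc (1 + x * D.real R) ^ (2 * n) ≤ Real.exp (x * D.real R) ^ (2 * n) := by
        gcongr
        linarith [Real.add_one_le_exp (x * D.real R)]
    _ = Real.exp (2 * n * x * D.real R) := by
        rw [← Real.exp_nat_mul]
        push_cast
        ring_nf

/-- The relative deviation bound of Vapnik and Chervonenkis, localized to the region `R`: the
sample size enters only through `n * D R`, with a factor `x` that can be chosen small. -/
theorem pi_exists_lt_inter_errSet_le [Countable Q]
    (hd : ∀ F : Finset X, Shatters H F → F.card ≤ d) (D : Measure (X × Label))
    [IsProbabilityMeasure D] {R : Set (X × Label)} (hR : MeasurableSet R) {x : ℝ} (hx0 : 0 < x)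
    (hx : x ≤ 1) {n : ℕ} (V : Q → (Fin n → X × Label) → Hyp X) (hVH : ∀ q s, V q s ∈ H)
    (hV : ∀ q, Measurable fun p : (Fin n → X × Label) × X => V q p.1 p.2) {δ : ℝ} (hδ : 0 < δ) :
    (Measure.pi fun _ : Fin n => D) {s | ∃ q,
        3 * (errCount (V q s) (List.ofFn s) + d * Real.log (1 / x) + 2 * n * x * D.real R +
          Real.log (1 / δ)) < n * D.real (R ∩ errSet (V q s))} ≤ ENNReal.ofReal δ := by
  let f : (Fin n → X × Label) → ℝ≥0∞ := fun s => ⨆ q,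
    (1 + 2⁻¹ * D (R ∩ errSet (V q s))) ^ n * ∏ i, weight (1 - 2⁻¹) (R ∩ errSet (V q s)) (s i)
  set B : ℝ := d * Real.log (1 / x) + 2 * n * x * D.real R
  have hf : ∫⁻ s, f s ∂(Measure.pi fun _ : Fin n => D) ≤ ENNReal.ofReal (Real.exp B) := by
    have hle := lintegral_iSup_inter_errSet_le hd D (c := 2⁻¹) (by simp) hR
      (Real.toNNReal_pos.2 hx0).ne' (Real.toNNReal_le_one.2 hx) V hVH hV
    rw [Fintype.card_fin] at hle
    exact hle.trans (inv_pow_mul_one_add_pow_le_exp D R hx0 d n)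
  have hsub : {s | ∃ q, 3 * (errCount (V q s) (List.ofFn s) + d * Real.log (1 / x) +
      2 * n * x * D.real R + Real.log (1 / δ)) < n * D.real (R ∩ errSet (V q s))} ⊆
        {s | ENNReal.ofReal (Real.exp (B + Real.log (1 / δ))) ≤ f s} := by
    rintro s ⟨q, hq⟩
    refine le_trans (ENNReal.ofReal_le_ofReal (Real.exp_le_exp.2 ?_))
      ((ofReal_exp_le_weight D R (V q s) s).trans (le_iSup_iff.2 fun b hb => hb q))
    linarith
  exact (measure_mono hsub).trans
    (measure_ofReal_exp_add_log_le (measurable_iSup_weight D _ n hR hV) hδ hf)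

end UniformDeviation

section Split

variable {Z W X : Type*}

theorem split_map (f : Z → W) (k : ℕ) (S T : List Z) :
    split k (S.map f) (T.map f) = (split k S T).map (List.map f) := by
  induction k using Nat.strong_induction_on generalizing S T with
  | _ k ih =>
    rw [split, split]
    split_ifs with hk
    · rw [List.map_flatMap]
      refine List.flatMap_congr fun i _ => ?_
      rw [← ih _ (by omega)]
      simp [block, List.map_take, List.map_drop]
    · simp

theorem block_sublist (k : ℕ) (S : List Z) (i : ℕ) : (block k S i).Sublist S :=
  (List.take_sublist _ _).trans (List.drop_sublist _ _)

theorem suffix_of_mem_split {k : ℕ} {S T L : List Z} (hL : L ∈ split k S T) : T <:+ L := by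
  induction k using Nat.strong_induction_on generalizing S T with
  | _ k ih =>
    rw [split] at hL
    split_ifs at hL with hk
    · obtain ⟨i, -, hi⟩ := List.mem_flatMap.1 hL
      exact (List.suffix_append _ _).trans (ih _ (by omega) hi)
    · rw [List.mem_singleton.1 hL]
      exact List.suffix_append S T

theorem sublist_of_mem_split {k : ℕ} {S T L : List Z} (hL : L ∈ split k S T) :
    L.Sublist (S ++ T) := by
  induction k using Nat.strong_induction_on generalizing S T with
  | _ k ih =>
    rw [split] at hL
    split_ifs at hL with hk
    · obtain ⟨i, -, hi⟩ := List.mem_flatMap.1 hL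
      refine (ih _ (by omega) hi).trans ?_
      rw [← List.append_assoc, List.take_append_drop]
      exact (block_sublist k S i).append_right T
    · rw [List.mem_singleton.1 hL]

theorem exists_mem_split_allVoters_eq (A : Learner X) (k : ℕ) (S T : List (X × Label))
    (j : Fin (27 ^ (k / 6))) : ∃ L ∈ split k S T, allVoters A k S T j = A L :=
  ⟨_, List.get_mem _ _, rfl⟩

theorem IsERM.allVoters_mem {H : Set (Hyp X)} {A : Learner X} (hA : IsERM H A) (k : ℕ)
    (S T : List (X × Label)) (j : Fin (27 ^ (k / 6))) : allVoters A k S T j ∈ H :=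
  (hA _).1

theorem IsERM.errCount_allVoters_le {H : Set (Hyp X)} {A : Learner X} (hA : IsERM H A) {h : Hyp X}
    (hh : h ∈ H) (k : ℕ) (S T : List (X × Label)) (j : Fin (27 ^ (k / 6))) :
    errCount (allVoters A k S T j) T ≤ errCount h (S ++ T) := by
  obtain ⟨L, hL, hj⟩ := exists_mem_split_allVoters_eq A k S T j
  rw [hj]
  calc errCount (A L) T
      ≤ errCount (A L) L := errCount_le_of_sublist _ (suffix_of_mem_split hL).sublist
    _ ≤ errCount h L := hA.errCount_le L hh
    _ ≤ errCount h (S ++ T) := errCount_le_of_sublist _ (sublist_of_mem_split hL)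

theorem avgErr_allVoters (A : Learner X) (k : ℕ) (S T : List (X × Label)) (z : X × Label) :
    avgErr (allVoters A k S T) z =
      ((split k S T).map fun L => if A L z.1 ≠ z.2 then (1 : ℝ) else 0).sum / 27 ^ (k / 6) := by
  rw [avgErr, Nat.cast_pow, Nat.cast_ofNat, ← List.sum_ofFn]
  congr 2
  refine List.ext_getElem (by simp [length_split]) fun i _ _ => ?_
  rw [List.getElem_map, List.getElem_ofFn]
  rfl

end Split

section Measurability

variable {Ω Z X : Type*} [MeasurableSpace Ω]

/-- A random list of constant length whose entries depend measurably on `ω`. -/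
def MeasurableList [MeasurableSpace Z] (L : Ω → List Z) : Prop :=
  ∃ (n : ℕ) (l : Ω → Fin n → Z), Measurable l ∧ ∀ ω, L ω = List.ofFn (l ω)

namespace MeasurableList

variable [MeasurableSpace Z]

theorem const (L : List Z) : MeasurableList fun _ : Ω => L :=
  ⟨L.length, fun _ => L.get, measurable_const, fun _ => (List.ofFn_get L).symm⟩

theorem ofFn {n : ℕ} {l : Ω → Fin n → Z} (hl : Measurable l) :
    MeasurableList fun ω => List.ofFn (l ω) :=
  ⟨n, l, hl, fun _ => rfl⟩

theorem append {L L' : Ω → List Z} (hL : MeasurableList L) (hL' : MeasurableList L') :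
    MeasurableList fun ω => L ω ++ L' ω := by
  obtain ⟨n, l, hl, h⟩ := hL
  obtain ⟨n', l', hl', h'⟩ := hL'
  refine ⟨n + n', fun ω => Fin.append (l ω) (l' ω), measurable_pi_iff.2 fun i => ?_, fun ω => ?_⟩
  · refine Fin.addCases (fun j => ?_) (fun j => ?_) i
    · simp only [Fin.append_left]; fun_prop
    · simp only [Fin.append_right]; fun_prop
  · simp only [h, h', List.ofFn_fin_append]

/-- The positions of the entries chosen by `split` do not depend on the lists: they are found by
splitting a list of distinct symbols. -/
theorem get_split {S T : Ω → List Z} (hS : MeasurableList S) (hT : MeasurableList T) (k : ℕ)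
    (j : Fin (27 ^ (k / 6))) :
    MeasurableList fun ω => (split k (S ω) (T ω)).get (j.cast (length_split k _ _).symm) := by
  obtain ⟨a, s, hs, hS⟩ := hS
  obtain ⟨b, t, ht, hT⟩ := hT
  let L : List (List (Fin a ⊕ Fin b)) := split k (List.ofFn Sum.inl) (List.ofFn Sum.inr)
  let l : List (Fin a ⊕ Fin b) := L.get (j.cast (length_split k _ _).symm)
  have hf (c : Fin a ⊕ Fin b) : Measurable fun ω => Sum.elim (s ω) (t ω) c := by
    rcases c with c | c
    · exact (measurable_pi_apply c).comp hs
    · exact (measurable_pi_apply c).comp ht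
  have hsplit (ω : Ω) : split k (S ω) (T ω) = L.map (List.map (Sum.elim (s ω) (t ω))) := by
    rw [← split_map, List.map_ofFn, List.map_ofFn, hS, hT]
    rfl
  refine ⟨l.length, fun ω i => Sum.elim (s ω) (t ω) (l.get i),
    measurable_pi_iff.2 fun i => hf (l.get i), fun ω => ?_⟩
  calc (split k (S ω) (T ω)).get (j.cast (length_split k _ _).symm)
      = l.map (Sum.elim (s ω) (t ω)) := by simp [l, hsplit]
    _ = _ := by
      conv_lhs => rw [← List.ofFn_get l, List.map_ofFn]
      rfl

end MeasurableList

variable [MeasurableSpace X] {A : Learner X} {S T : Ω → List (X × Label)}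

theorem IsMeasurableLearner.measurable_apply (hA : IsMeasurableLearner A)
    (hS : MeasurableList S) : Measurable fun p : Ω × X => A (S p.1) p.2 := by
  obtain ⟨n, s, hs, hS⟩ := hS
  simp only [hS]
  exact (hA n).comp (by fun_prop : Measurable fun p : Ω × X => (s p.1, p.2))

theorem IsMeasurableLearner.measurable_allVoters (hA : IsMeasurableLearner A)
    (hS : MeasurableList S) (hT : MeasurableList T) (k : ℕ) (j : Fin (27 ^ (k / 6))) :
    Measurable fun p : Ω × X => allVoters A k (S p.1) (T p.1) j p.2 :=
  hA.measurable_apply (hS.get_split hT k j)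

theorem MeasurableList.measurable_errCount (hS : MeasurableList S) {V : Ω → Hyp X}
    (hV : Measurable fun p : Ω × X => V p.1 p.2) : Measurable fun ω => errCount (V ω) (S ω) := by
  obtain ⟨n, s, hs, hS⟩ := hS
  simp only [hS, errCount_ofFn]
  exact Finset.measurable_fun_sum _ fun i _ => Measurable.ite
    (measurableSet_setOf_mem_errSet hV ((measurable_pi_apply i).comp hs)) measurable_const
    measurable_const

/-- The examples on which at least an `α`-fraction of the voters `V` errs; its measure is
`voteError D α V`. -/
def voteErrSet (α : ℝ) {t : ℕ} (V : Fin t → Hyp X) : Set (X × Label) := {z | α ≤ avgErr V z}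

theorem measurable_avgErr {t : ℕ} {V : Ω → Fin t → Hyp X}
    (hV : ∀ i, Measurable fun p : Ω × X => V p.1 i p.2) :
    Measurable fun p : Ω × (X × Label) => avgErr (V p.1) p.2 :=
  (Finset.measurable_fun_sum _ fun i _ => Measurable.ite
    (measurableSet_prod_errSet (V := fun ω => V ω i) (hV i)) measurable_const
    measurable_const).div_const _

theorem measurableSet_prod_voteErrSet (α : ℝ) {t : ℕ} {V : Ω → Fin t → Hyp X}
    (hV : ∀ i, Measurable fun p : Ω × X => V p.1 i p.2) :
    MeasurableSet {p : Ω × (X × Label) | p.2 ∈ voteErrSet α (V p.1)} :=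
  measurableSet_le measurable_const (measurable_avgErr hV)

end Measurability

section Blocks

variable {Z X : Type*} {l : ℕ}

/-- The positions of a sample of size `3 ^ (l + 6)`, listed by block: `(i, .inl a)` is the position
of the entry `a` of the head of the block `i`, and `(i, .inr b)` that of the entry `b` of its
tail. -/
def blockPos (l : ℕ) : Fin 27 × (Fin (3 ^ l) ⊕ Fin (26 * 3 ^ l)) ≃ Fin (3 ^ (l + 6)) :=
  ((Equiv.refl _).prodCongr finSumFinEquiv).trans (finProdFinEquiv.trans (finCongr (by ring)))

/-- The positions of the head of the block `i`. -/
def headPos (l : ℕ) (i : Fin 27) (a : Fin (3 ^ l)) : Fin (3 ^ (l + 6)) := blockPos l (i, .inl a)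

/-- The positions of the tail of the block `i`. -/
def tailPos (l : ℕ) (i : Fin 27) (b : Fin (26 * 3 ^ l)) : Fin (3 ^ (l + 6)) :=
  blockPos l (i, .inr b)

theorem headPos_injective (l : ℕ) (i : Fin 27) : (headPos l i).Injective :=
  (blockPos l).injective.comp ((Prod.mk_right_injective i).comp Sum.inl_injective)

theorem tailPos_injective (l : ℕ) (i : Fin 27) : (tailPos l i).Injective :=
  (blockPos l).injective.comp ((Prod.mk_right_injective i).comp Sum.inr_injective)

/-- The first `3 ^ l` entries of the block `i` of the sample `s`. -/
def headPart (s : Fin (3 ^ (l + 6)) → Z) (i : Fin 27) : List Z := List.ofFn (s ∘ headPos l i)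

/-- The remaining entries of the block `i` of the sample `s`. -/
def tailPart (s : Fin (3 ^ (l + 6)) → Z) (i : Fin 27) : List Z := List.ofFn (s ∘ tailPos l i)

theorem block_ofFn (s : Fin (3 ^ (l + 6)) → Z) (i : Fin 27) :
    block (l + 6) (List.ofFn s) i = headPart s i ++ tailPart s i := by
  have hblock : 3 ^ (l + 6 - 3) = 3 ^ l + 26 * 3 ^ l := by
    rw [show l + 6 - 3 = l + 3 by omega]
    ring
  have htotal : 3 ^ (l + 6) = 27 * (3 ^ l + 26 * 3 ^ l) := by ring
  have hi := Nat.mul_le_mul_right (3 ^ l + 26 * 3 ^ l) (Nat.succ_le_of_lt i.2)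
  rw [Nat.succ_mul] at hi
  rw [block, hblock, headPart, tailPart]
  refine List.ext_getElem ?_ fun a _ _ => ?_
  · simp only [List.length_take, List.length_drop, List.length_append, List.length_ofFn]
    omega
  · simp only [List.getElem_take, List.getElem_drop, List.getElem_append, List.getElem_ofFn,
      Function.comp_apply]
    split_ifs with ha
    all_goals
      rw [List.length_ofFn] at ha
      congr 1
      ext
      simp only [headPos, tailPos, blockPos, Equiv.trans_apply, Equiv.prodCongr_apply,
        Prod.map_apply, finSumFinEquiv_apply_left, finSumFinEquiv_apply_right, Fin.val_cast,
        finCongr_apply, finProdFinEquiv_apply_val, Fin.val_castAdd, Fin.val_natAdd,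
        List.length_ofFn, mul_comm (i : ℕ), Equiv.refl_apply]
      omega

theorem take_block_ofFn (s : Fin (3 ^ (l + 6)) → Z) (i : Fin 27) :
    (block (l + 6) (List.ofFn s) i).take (3 ^ l) = headPart s i := by
  rw [block_ofFn, List.take_left' (by simp [headPart])]

theorem drop_block_ofFn (s : Fin (3 ^ (l + 6)) → Z) (i : Fin 27) :
    (block (l + 6) (List.ofFn s) i).drop (3 ^ l) = tailPart s i := by
  rw [block_ofFn, List.drop_left' (by simp [headPart])]

theorem split_ofFn_add_six (s : Fin (3 ^ (l + 6)) → Z) (T : List Z) :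
    split (l + 6) (List.ofFn s) T =
      (List.finRange 27).flatMap fun i => split l (headPart s i) (tailPart s i ++ T) := by
  rw [split, if_pos (by omega), Nat.add_sub_cancel, ← List.map_coe_finRange_eq_range,
    List.flatMap_map]
  simp only [take_block_ofFn, drop_block_ofFn]

theorem headPart_append_tailPart_sublist (s : Fin (3 ^ (l + 6)) → Z) (i : Fin 27) :
    (headPart s i ++ tailPart s i).Sublist (List.ofFn s) :=
  block_ofFn s i ▸ block_sublist _ _ _

theorem headPart_extend_headPos (i : Fin 27) (u : Fin (3 ^ l) → Z) (s : Fin (3 ^ (l + 6)) → Z) :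
    headPart (Function.extend (headPos l i) u s) i = List.ofFn u := by
  rw [headPart, Function.extend_comp (headPos_injective l i)]

theorem tailPart_extend_tailPos (i : Fin 27) (u : Fin (26 * 3 ^ l) → Z)
    (s : Fin (3 ^ (l + 6)) → Z) :
    tailPart (Function.extend (tailPos l i) u s) i = List.ofFn u := by
  rw [tailPart, Function.extend_comp (tailPos_injective l i)]

theorem extend_comp_of_forall_ne {ι κ μ : Type*} {f : ι → κ} {g : μ → κ} (h : ∀ a b, f a ≠ g b)
    (u : ι → Z) (s : κ → Z) : Function.extend f u s ∘ g = s ∘ g :=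
  funext fun b => Function.extend_apply' _ _ _ fun ⟨a, hab⟩ => h a b hab

theorem tailPart_extend_headPos (i j : Fin 27) (u : Fin (3 ^ l) → Z)
    (s : Fin (3 ^ (l + 6)) → Z) :
    tailPart (Function.extend (headPos l i) u s) j = tailPart s j := by
  rw [tailPart, extend_comp_of_forall_ne (fun a b => ?_), tailPart]
  simp [headPos, tailPos]

theorem headPart_extend_tailPos (i j : Fin 27) (u : Fin (26 * 3 ^ l) → Z)
    (s : Fin (3 ^ (l + 6)) → Z) :
    headPart (Function.extend (tailPos l i) u s) j = headPart s j := by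
  rw [headPart, extend_comp_of_forall_ne (fun a b => ?_), headPart]
  simp [headPos, tailPos]

theorem tailPart_extend_tailPos_of_ne {i j : Fin 27} (hij : i ≠ j) (u : Fin (26 * 3 ^ l) → Z)
    (s : Fin (3 ^ (l + 6)) → Z) :
    tailPart (Function.extend (tailPos l i) u s) j = tailPart s j := by
  rw [tailPart, extend_comp_of_forall_ne (fun a b => ?_), tailPart]
  simp [tailPos, hij]

/-- The voters trained on the block `i` of the sample `s` by the recursive call. -/
def blockVoters (A : Learner X) (s : Fin (3 ^ (l + 6)) → X × Label) (T : List (X × Label))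
    (i : Fin 27) : Fin (27 ^ (l / 6)) → Hyp X :=
  allVoters A l (headPart s i) (tailPart s i ++ T)

theorem avgErr_allVoters_add_six (A : Learner X) (s : Fin (3 ^ (l + 6)) → X × Label)
    (T : List (X × Label)) (z : X × Label) :
    avgErr (allVoters A (l + 6) (List.ofFn s) T) z =
      (∑ i, avgErr (blockVoters A s T i) z) / 27 := by
  have hpow : (27 : ℝ) ^ ((l + 6) / 6) = 27 ^ (l / 6) * 27 := by
    rw [Nat.add_div_right l (by norm_num), pow_succ]
  simp only [blockVoters, avgErr_allVoters, ← Finset.sum_div, div_div, hpow]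
  rw [split_ofFn_add_six, List.map_flatMap, List.flatMap_def, List.sum_flatten, List.map_map,
    Fin.sum_univ_def]
  rfl

variable {H : Set (Hyp X)} {A : Learner X} {h : Hyp X}

theorem errCount_parts_le (h : Hyp X) (s : Fin (3 ^ (l + 6)) → X × Label) (T : List (X × Label))
    (i : Fin 27) :
    errCount h (headPart s i ++ (tailPart s i ++ T)) ≤ errCount h (List.ofFn s ++ T) := by
  rw [← List.append_assoc]
  exact errCount_le_of_sublist h ((headPart_append_tailPart_sublist s i).append_right T)

theorem IsERM.errCount_blockVoters_tailPart_le (hA : IsERM H A) (hh : h ∈ H)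
    (s : Fin (3 ^ (l + 6)) → X × Label) (T : List (X × Label)) (i : Fin 27)
    (q : Fin (27 ^ (l / 6))) :
    errCount (blockVoters A s T i q) (tailPart s i) ≤ errCount h (List.ofFn s ++ T) :=
  (errCount_le_of_sublist _ (List.sublist_append_left _ T)).trans
    ((hA.errCount_allVoters_le hh l _ _ q).trans (errCount_parts_le h s T i))

end Blocks

section Voting

variable {ι X : Type*} {n : ℕ}

theorem avgErr_nonneg (V : Fin n → Hyp X) (z : X × Label) : 0 ≤ avgErr V z := by
  rw [avgErr]
  positivity

theorem avgErr_eq_sum_indicator (V : Fin n → Hyp X) (z : X × Label) :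
    avgErr V z = (∑ i, (errSet (V i)).indicator 1 z) / n := by
  simp only [avgErr, Set.indicator_apply, errSet, Set.mem_ofPred_eq, Pi.one_apply]

theorem avgErr_le_one (V : Fin n → Hyp X) (z : X × Label) : avgErr V z ≤ 1 := by
  rw [avgErr]
  refine div_le_one_of_le₀ ?_ (Nat.cast_nonneg n)
  calc _ ≤ ∑ _i : Fin n, (1 : ℝ) := Finset.sum_le_sum fun i _ => by split_ifs <;> simp
    _ = n := by simp

theorem exists_le_and_sub_one_le_sum_erase [Fintype ι] [Nonempty ι] [DecidableEq ι] {a : ι → ℝ}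
    (ha : ∀ i, a i ≤ 1) {α : ℝ} (h : α * Fintype.card ι ≤ ∑ i, a i) :
    ∃ i, α ≤ a i ∧ α * Fintype.card ι - 1 ≤ ∑ j ∈ Finset.univ.erase i, a j := by
  obtain ⟨i, -, hi⟩ : ∃ i ∈ Finset.univ, α ≤ a i :=
    Finset.exists_le_of_sum_le Finset.univ_nonempty (by simpa [mul_comm] using h)
  refine ⟨i, hi, ?_⟩
  rw [Finset.sum_erase_eq_sub (Finset.mem_univ i)]
  linarith [ha i]

/-- If an `α`-fraction of all voters errs on `z`, then so does an `α`-fraction of the voters of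
some `V i`, while the other `V j` still carry a total error of `α * card ι - 1`. -/
theorem indicator_le_sum_erase_indicator_avgErr [Fintype ι] [Nonempty ι] [DecidableEq ι]
    (V : ι → Fin n → Hyp X) (α : ℝ) (z : X × Label) :
    {z | α * Fintype.card ι ≤ ∑ i, avgErr (V i) z}.indicator
        (fun _ => α * Fintype.card ι - 1) z ≤
      ∑ i, ∑ j ∈ Finset.univ.erase i, (voteErrSet α (V i)).indicator (avgErr (V j)) z := by
  have hnonneg (i : ι) : 0 ≤ ∑ j ∈ Finset.univ.erase i,
      (voteErrSet α (V i)).indicator (avgErr (V j)) z :=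
    Finset.sum_nonneg fun j _ => Set.indicator_nonneg (fun z _ => avgErr_nonneg _ z) z
  refine Set.indicator_apply_le' (fun hz => ?_) fun _ => Finset.sum_nonneg fun i _ => hnonneg i
  obtain ⟨i, hi, hsum⟩ := exists_le_and_sub_one_le_sum_erase (fun i => avgErr_le_one (V i) z) hz
  have hzi : z ∈ voteErrSet α (V i) := hi
  refine le_trans ?_ (Finset.single_le_sum (fun i _ => hnonneg i) (Finset.mem_univ i))
  simpa only [Set.indicator_of_mem hzi] using hsum

variable [MeasurableSpace X]

theorem measurable_avgErr_of_errSet {V : Fin n → Hyp X} (hV : ∀ q, MeasurableSet (errSet (V q))) :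
    Measurable (avgErr V) := by
  have hsum : avgErr V = fun z => (∑ q, (errSet (V q)).indicator 1 z : ℝ) / n :=
    funext (avgErr_eq_sum_indicator V)
  rw [hsum]
  exact (Finset.measurable_fun_sum _ fun q _ => measurable_one.indicator (hV q)).div_const _

variable (D : Measure (X × Label)) [IsProbabilityMeasure D]

theorem setIntegral_avgErr_le {V : Fin n → Hyp X} (hV : ∀ q, MeasurableSet (errSet (V q)))
    (R : Set (X × Label)) {β : ℝ} (hβ : 0 ≤ β) (h : ∀ q, D.real (R ∩ errSet (V q)) ≤ β) :
    ∫ z in R, avgErr V z ∂D ≤ β := by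
  have hintegrable (q : Fin n) : Integrable ((errSet (V q)).indicator (1 : X × Label → ℝ))
    (D.restrict R) := (integrable_const 1).indicator (hV q)
  simp only [avgErr_eq_sum_indicator]
  rw [integral_div, integral_finsetSum _ fun q _ => hintegrable q]
  refine div_le_of_le_mul₀ (Nat.cast_nonneg n) hβ ?_
  calc _ ≤ ∑ _q : Fin n, β := Finset.sum_le_sum fun q _ => by
        rw [integral_indicator_one (hV q), measureReal_restrict_apply (hV q), Set.inter_comm]
        exact h q
    _ = β * n := by simp [mul_comm]

theorem mul_measureReal_le_sum_avgErr_le [Fintype ι] [Nonempty ι] {V : ι → Fin n → Hyp X}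
    (hV : ∀ i q, MeasurableSet (errSet (V i q))) {α β : ℝ} (hβ : 0 ≤ β)
    (h : ∀ i j, i ≠ j → ∀ q, D.real (voteErrSet α (V i) ∩ errSet (V j q)) ≤ β) :
    (α * Fintype.card ι - 1) * D.real {z | α * Fintype.card ι ≤ ∑ i, avgErr (V i) z} ≤
      Fintype.card ι ^ 2 * β := by
  classical
  have hm (i : ι) : Measurable (avgErr (V i)) := measurable_avgErr_of_errSet (hV i)
  have hR (i : ι) : MeasurableSet (voteErrSet α (V i)) := measurableSet_le measurable_const (hm i)
  have hE : MeasurableSet {z | α * Fintype.card ι ≤ ∑ i, avgErr (V i) z} :=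
    measurableSet_le measurable_const (Finset.measurable_fun_sum _ fun i _ => hm i)
  have hintegrable (i j : ι) : Integrable ((voteErrSet α (V i)).indicator (avgErr (V j))) D :=
    (Integrable.of_bound (hm j).aestronglyMeasurable 1 <| .of_forall fun z => by
      rw [Real.norm_of_nonneg (avgErr_nonneg _ _)]
      exact avgErr_le_one _ _).indicator (hR i)
  calc (α * Fintype.card ι - 1) * D.real {z | α * Fintype.card ι ≤ ∑ i, avgErr (V i) z}
      = ∫ z, {z | α * Fintype.card ι ≤ ∑ i, avgErr (V i) z}.indicator
          (fun _ => α * Fintype.card ι - 1) z ∂D := by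
        rw [integral_indicator_const _ hE, smul_eq_mul, mul_comm]
    _ ≤ ∫ z, ∑ i, ∑ j ∈ Finset.univ.erase i,
          (voteErrSet α (V i)).indicator (avgErr (V j)) z ∂D :=
        integral_mono ((integrable_const _).indicator hE)
          (integrable_finsetSum _ fun i _ => integrable_finsetSum _ fun j _ => hintegrable i j)
          (indicator_le_sum_erase_indicator_avgErr V α)
    _ = ∑ i, ∑ j ∈ Finset.univ.erase i, ∫ z in voteErrSet α (V i), avgErr (V j) z ∂D := by
        rw [integral_finsetSum _ fun i _ => integrable_finsetSum _ fun j _ => hintegrable i j]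
        refine Finset.sum_congr rfl fun i _ => ?_
        rw [integral_finsetSum _ fun j _ => hintegrable i j]
        exact Finset.sum_congr rfl fun j _ => integral_indicator (hR i)
    _ ≤ ∑ i, ∑ _j ∈ Finset.univ.erase i, β := by
        refine Finset.sum_le_sum fun i _ => Finset.sum_le_sum fun j hj => ?_
        exact setIntegral_avgErr_le D (hV j) _ hβ (h i j (Finset.ne_of_mem_erase hj).symm)
    _ ≤ ∑ _i : ι, ∑ _j : ι, β := by
        gcongr
        exact Finset.erase_subset _ _
    _ = Fintype.card ι ^ 2 * β := by simp [sq, mul_assoc]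

end Voting

section Recursion

theorem measure_iUnion_union_iUnion_iUnion_le {Ω ι : Type*} [Fintype ι] [MeasurableSpace Ω]
    {μ : Measure Ω} {E : ι → Set Ω} {F : ι → ι → Set Ω} {a b : ℝ} (ha : 0 ≤ a) (hb : 0 ≤ b)
    (hE : ∀ i, μ (E i) ≤ ENNReal.ofReal a)
    (hF : ∀ i j, i ≠ j → μ (F i j) ≤ ENNReal.ofReal b) :
    μ ((⋃ i, E i) ∪ ⋃ i, ⋃ j, {ω | i ≠ j ∧ ω ∈ F i j}) ≤
      ENNReal.ofReal (Fintype.card ι * a + Fintype.card ι ^ 2 * b) := by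
  have hF' (i j : ι) : μ {ω | i ≠ j ∧ ω ∈ F i j} ≤ ENNReal.ofReal b := by
    by_cases hij : i = j
    · simp [hij]
    · simpa [hij] using hF i j hij
  calc μ ((⋃ i, E i) ∪ ⋃ i, ⋃ j, {ω | i ≠ j ∧ ω ∈ F i j})
      ≤ ∑ i, μ (E i) + ∑ i, ∑ j, μ {ω | i ≠ j ∧ ω ∈ F i j} :=
        (measure_union_le _ _).trans <| add_le_add (measure_iUnion_fintype_le μ _) <|
          (measure_iUnion_fintype_le μ _).trans <|
            Finset.sum_le_sum fun i _ => measure_iUnion_fintype_le μ _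
    _ ≤ ∑ _i : ι, ENNReal.ofReal a + ∑ _i : ι, ∑ _j : ι, ENNReal.ofReal b := by
        gcongr with i _ i _ j
        exacts [hE i, hF' i j]
    _ = ENNReal.ofReal (Fintype.card ι * a + Fintype.card ι ^ 2 * b) := by
        rw [ENNReal.ofReal_add (by positivity) (by positivity), ENNReal.ofReal_mul (by positivity),
          ENNReal.ofReal_mul (by positivity)]
        simp [sq, mul_assoc, ENNReal.ofReal_mul]

theorem log_exp_one_div {δ : ℝ} (hδ : 0 < δ) :
    Real.log (Real.exp 1 / δ) = 1 + Real.log (1 / δ) := by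
  rw [Real.log_div (Real.exp_pos 1).ne' hδ.ne', Real.log_exp, one_div, Real.log_inv,
    sub_eq_add_neg]

theorem log_one_div_div_le {δ a : ℝ} (hδ : 0 < δ) (ha : 0 < a) {n : ℕ} (h : a ≤ 2 ^ n) :
    Real.log (1 / (δ / a)) ≤ Real.log (1 / δ) + n := by
  have hlog : Real.log a ≤ n := by
    calc Real.log a ≤ Real.log (2 ^ n) := Real.log_le_log ha h
      _ = n * Real.log 2 := by rw [Real.log_pow]
      _ ≤ n * 1 := by
          gcongr
          exact Real.log_two_lt_d9.le.trans (by norm_num)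
      _ = n := mul_one _
  rw [one_div_div, one_div, Real.log_inv, Real.log_div ha.ne' hδ.ne']
  linarith

variable {X : Type*} [MeasurableSpace X] {H : Set (Hyp X)} {A : Learner X} {h : Hyp X} {l d : ℕ}

theorem measurableList_headPart (i : Fin 27) :
    MeasurableList fun s : Fin (3 ^ (l + 6)) → X × Label => headPart s i :=
  MeasurableList.ofFn (measurable_pi_iff.2 fun a => measurable_pi_apply (headPos l i a))

theorem measurableList_tailPart (i : Fin 27) :
    MeasurableList fun s : Fin (3 ^ (l + 6)) → X × Label => tailPart s i :=
  MeasurableList.ofFn (measurable_pi_iff.2 fun b => measurable_pi_apply (tailPos l i b))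

theorem IsMeasurableLearner.measurable_blockVoters (hA : IsMeasurableLearner A)
    (T : List (X × Label)) (i : Fin 27) (q : Fin (27 ^ (l / 6))) :
    Measurable fun p : (Fin (3 ^ (l + 6)) → X × Label) × X => blockVoters A p.1 T i q p.2 :=
  hA.measurable_allVoters (measurableList_headPart i)
    ((measurableList_tailPart i).append (.const T)) l q

variable (D : Measure (X × Label))

/-- The event that the region where a `10 / 243` fraction of the voters of the block `i` errs is
larger than the bound provided by the recursive call on this block. -/
def regionFailure (A : Learner X) (h : Hyp X) (d : ℕ) (T : List (X × Label)) (δ : ℝ)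
    (i : Fin 27) : Set (Fin (3 ^ (l + 6)) → X × Label) :=
  {s | 3 ^ 18 * (errCount h (headPart s i ++ (tailPart s i ++ T)) + d +
      Real.log (Real.exp 1 / δ)) <
    (3 : ℝ) ^ l * D.real (voteErrSet (10 / 243) (blockVoters A s T i))}

/-- The event that, within the region where a `10 / 243` fraction of the voters of the block `i`
errs, the error of some voter of the block `j` is larger than the uniform deviation bound for the
tail of the block `j`. -/
def voterFailure (A : Learner X) (d : ℕ) (T : List (X × Label)) (δ : ℝ) (i j : Fin 27) :
    Set (Fin (3 ^ (l + 6)) → X × Label) :=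
  {s | ∃ q, 3 * (errCount (blockVoters A s T j q) (tailPart s j) +
      d * Real.log (1 / (1 / 3 ^ 18)) + 2 * (26 * 3 ^ l : ℕ) * (1 / 3 ^ 18) *
        D.real (voteErrSet (10 / 243) (blockVoters A s T i)) + Real.log (1 / δ)) <
    (26 * 3 ^ l : ℕ) *
      D.real (voteErrSet (10 / 243) (blockVoters A s T i) ∩ errSet (blockVoters A s T j q))}

theorem mul_measureReal_voteErrSet_le_of_notMem_regionFailure {s : Fin (3 ^ (l + 6)) → X × Label}
    {T : List (X × Label)} {δ : ℝ} (hδ : 0 < δ) (hδ1 : δ ≤ 1) {i : Fin 27}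
    (hs : s ∉ regionFailure D A h d T (δ / 54) i) :
    3 ^ l * D.real (voteErrSet (10 / 243) (blockVoters A s T i)) ≤
      3 ^ 18 * (7 * (errCount h (List.ofFn s ++ T) + d + Real.log (Real.exp 1 / δ))) := by
  rw [regionFailure, Set.mem_ofPred_eq, not_lt, log_exp_one_div (by positivity)] at hs
  have hE : (errCount h (headPart s i ++ (tailPart s i ++ T)) : ℝ) ≤
    errCount h (List.ofFn s ++ T) := Nat.cast_le.2 (errCount_parts_le h s T i)
  have hlog : 0 ≤ Real.log (1 / δ) := Real.log_nonneg (one_le_one_div hδ hδ1)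
  have hlog54 := log_one_div_div_le hδ (a := 54) (n := 6) (by norm_num) (by norm_num)
  have : (0 : ℝ) ≤ errCount h (List.ofFn s ++ T) + d := by positivity
  rw [log_exp_one_div hδ]
  push_cast at hlog54
  linarith

theorem measureReal_inter_le_of_notMem_voterFailure (hH : IsERM H A) (hh : h ∈ H)
    {s : Fin (3 ^ (l + 6)) → X × Label} {T : List (X × Label)} {δ : ℝ} (hδ : 0 < δ) (hδ1 : δ ≤ 1)
    {i j : Fin 27} (hi : s ∉ regionFailure D A h d T (δ / 54) i)
    (hij : s ∉ voterFailure D A d T (δ / 1458) i j) (q : Fin (27 ^ (l / 6))) :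
    D.real (voteErrSet (10 / 243) (blockVoters A s T i) ∩ errSet (blockVoters A s T j q)) ≤
      1200 * (errCount h (List.ofFn s ++ T) + d + Real.log (Real.exp 1 / δ)) / (26 * 3 ^ l) := by
  have hregion := mul_measureReal_voteErrSet_le_of_notMem_regionFailure D hδ hδ1 hi
  rw [voterFailure, Set.mem_ofPred_eq, not_exists] at hij
  have hvoter := not_lt.1 (hij q)
  have hE : (errCount (blockVoters A s T j q) (tailPart s j) : ℝ) ≤
    errCount h (List.ofFn s ++ T) := Nat.cast_le.2 (hH.errCount_blockVoters_tailPart_le hh s T j q)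
  have hlog : 0 ≤ Real.log (1 / δ) := Real.log_nonneg (one_le_one_div hδ hδ1)
  have hlog1458 := log_one_div_div_le hδ (a := 1458) (n := 11) (by norm_num) (by norm_num)
  have hlog3 : Real.log (1 / (1 / 3 ^ 18)) ≤ 36 := by
    rw [one_div_one_div, Real.log_pow]
    push_cast
    linarith [Real.log_le_sub_one_of_pos (x := 3) (by norm_num)]
  have hd : d * Real.log (1 / (1 / 3 ^ 18)) ≤ d * 36 := by gcongr
  have hd0 : (0 : ℝ) ≤ d := Nat.cast_nonneg d
  have hE0 : (0 : ℝ) ≤ errCount h (List.ofFn s ++ T) := Nat.cast_nonneg _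
  rw [log_exp_one_div hδ] at hregion ⊢
  push_cast at hvoter hlog1458
  rw [le_div_iff₀ (by positivity)]
  linarith

variable [IsProbabilityMeasure D]

theorem measurable_measureReal_voteErrSet {Ω : Type*} [MeasurableSpace Ω] (α : ℝ) {t : ℕ}
    {V : Ω → Fin t → Hyp X} (hV : ∀ i, Measurable fun p : Ω × X => V p.1 i p.2) :
    Measurable fun ω => D.real (voteErrSet α (V ω)) :=
  (measurable_measure_prodMk_left (measurableSet_prod_voteErrSet α hV)).ennreal_toReal

theorem measurable_measureReal_voteErrSet_inter_errSet {Ω : Type*} [MeasurableSpace Ω] (α : ℝ)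
    {t : ℕ} {V : Ω → Fin t → Hyp X} (hV : ∀ i, Measurable fun p : Ω × X => V p.1 i p.2)
    {g : Ω → Hyp X} (hg : Measurable fun p : Ω × X => g p.1 p.2) :
    Measurable fun ω => D.real (voteErrSet α (V ω) ∩ errSet (g ω)) :=
  (measurable_measure_prodMk_left <|
    (measurableSet_prod_voteErrSet α hV).inter (measurableSet_prod_errSet hg)).ennreal_toReal

theorem IsMeasurableLearner.measurableSet_regionFailure (hA : IsMeasurableLearner A)
    (hh : Measurable h) (d : ℕ) (T : List (X × Label)) (δ : ℝ) (i : Fin 27) :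
    MeasurableSet (regionFailure (l := l) D A h d T δ i) := by
  have hcount : Measurable fun s : Fin (3 ^ (l + 6)) → X × Label =>
      (errCount h (headPart s i ++ (tailPart s i ++ T)) : ℝ) :=
    measurable_from_top.comp (((measurableList_headPart i).append
      ((measurableList_tailPart i).append (.const T))).measurable_errCount
        (V := fun _ => h) (hh.comp measurable_snd))
  exact measurableSet_lt (((hcount.add_const _).add_const _).const_mul _)
    ((measurable_measureReal_voteErrSet D _ (hA.measurable_blockVoters T i)).const_mul _)

theorem IsMeasurableLearner.measurableSet_voterFailure (hA : IsMeasurableLearner A) (d : ℕ)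
    (T : List (X × Label)) (δ : ℝ) (i j : Fin 27) :
    MeasurableSet (voterFailure (l := l) D A d T δ i j) := by
  rw [voterFailure, Set.ofPred_exists]
  refine MeasurableSet.iUnion fun q => ?_
  have hV := hA.measurable_blockVoters (l := l) T j q
  have hcount : Measurable fun s : Fin (3 ^ (l + 6)) → X × Label =>
      (errCount (blockVoters A s T j q) (tailPart s j) : ℝ) :=
    measurable_from_top.comp ((measurableList_tailPart j).measurable_errCount hV)
  have hregion := measurable_measureReal_voteErrSet D (10 / 243)
    (V := fun s => blockVoters A s T i) (hA.measurable_blockVoters (l := l) T i)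
  have hinter := measurable_measureReal_voteErrSet_inter_errSet D (10 / 243)
    (V := fun s => blockVoters A s T i) (hA.measurable_blockVoters (l := l) T i)
    (g := fun s => blockVoters A s T j q) hV
  exact measurableSet_lt
    ((((hcount.add_const _).add (hregion.const_mul _)).add_const _).const_mul _)
    (hinter.const_mul _)

/-- Given all other entries of the sample, the tail of the block `j` is a fresh sample for the
voters of the block `j` and the region of the block `i`. -/
theorem pi_voterFailure_le (hd : ∀ F : Finset X, Shatters H F → F.card ≤ d) (hH : IsERM H A)
    (hA : IsMeasurableLearner A) (T : List (X × Label)) {δ : ℝ} (hδ : 0 < δ) {i j : Fin 27}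
    (hij : i ≠ j) :
    (Measure.pi fun _ => D) (voterFailure (l := l) D A d T δ i j) ≤ ENNReal.ofReal δ := by
  refine pi_le_of_forall_extend_le _ (tailPos_injective l j)
    (hA.measurableSet_voterFailure D d T δ i j) fun s => ?_
  have hregion : MeasurableSet (voteErrSet (10 / 243) (blockVoters A s T i)) :=
    measurable_prodMk_left (x := s) <| measurableSet_prod_voteErrSet (10 / 243)
      (V := fun s => blockVoters A s T i) (hA.measurable_blockVoters T i)
  have hV (q : Fin (27 ^ (l / 6))) : Measurable fun p : (Fin (26 * 3 ^ l) → X × Label) × X =>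
      allVoters A l (headPart s j) (List.ofFn p.1 ++ T) q p.2 :=
    hA.measurable_allVoters (.const _) ((MeasurableList.ofFn measurable_id).append (.const T)) l q
  simp only [voterFailure, Set.mem_ofPred_eq, blockVoters, headPart_extend_tailPos,
    tailPart_extend_tailPos, tailPart_extend_tailPos_of_ne hij.symm]
  exact pi_exists_lt_inter_errSet_le hd D hregion (by positivity) (by norm_num)
    (fun q u => allVoters A l (headPart s j) (List.ofFn u ++ T) q)
    (fun q u => hH.allVoters_mem l _ _ q) hV hδ

theorem pi_regionFailure_le (hA : IsMeasurableLearner A) (hh : Measurable h) {δ : ℝ}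
    (ih : ∀ T, (Measure.pi fun _ : Fin (3 ^ l) => D)
      {s | 3 ^ 18 * (errCount h (List.ofFn s ++ T) + d + Real.log (Real.exp 1 / δ)) <
        (3 : ℝ) ^ l * D.real (voteErrSet (10 / 243) (allVoters A l (List.ofFn s) T))} ≤
      ENNReal.ofReal δ) (T : List (X × Label)) (i : Fin 27) :
    (Measure.pi fun _ => D) (regionFailure (l := l) D A h d T δ i) ≤ ENNReal.ofReal δ := by
  refine pi_le_of_forall_extend_le _ (headPos_injective l i)
    (hA.measurableSet_regionFailure D hh d T δ i) fun s => ?_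
  simp only [regionFailure, Set.mem_ofPred_eq, blockVoters, headPart_extend_headPos,
    tailPart_extend_headPos]
  exact ih (tailPart s i ++ T)

theorem measureReal_voteErrSet_allVoters_add_six_le {s : Fin (3 ^ (l + 6)) → X × Label}
    {T : List (X × Label)} (hV : ∀ i q, MeasurableSet (errSet (blockVoters A s T i q))) {β : ℝ}
    (hβ : 0 ≤ β)
    (h : ∀ i j, i ≠ j → ∀ q,
      D.real (voteErrSet (10 / 243) (blockVoters A s T i) ∩ errSet (blockVoters A s T j q)) ≤ β) :
    D.real (voteErrSet (10 / 243) (allVoters A (l + 6) (List.ofFn s) T)) ≤ 9 * 729 * β := by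
  have hset : voteErrSet (10 / 243) (allVoters A (l + 6) (List.ofFn s) T) =
      {z | 10 / 243 * (Fintype.card (Fin 27) : ℝ) ≤ ∑ i, avgErr (blockVoters A s T i) z} := by
    ext z
    rw [voteErrSet, Set.mem_ofPred_eq, avgErr_allVoters_add_six, le_div_iff₀ (by norm_num),
      Fintype.card_fin]
    rfl
  have hle := mul_measureReal_le_sum_avgErr_le D hV hβ h
  rw [← hset, Fintype.card_fin] at hle
  norm_num at hle
  linarith

theorem pow_mul_measureReal_le_of_lt_six {k : ℕ} (hk : k < 6) {δ : ℝ} (hδ : 0 < δ) (hδ1 : δ ≤ 1)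
    (n d : ℕ) (R : Set (X × Label)) :
    3 ^ k * D.real R ≤ 3 ^ 18 * (n + d + Real.log (Real.exp 1 / δ)) := by
  have hpow : (3 : ℝ) ^ k ≤ 3 ^ 18 := pow_le_pow_right₀ (by norm_num) (by omega)
  have hlog : 0 ≤ Real.log (1 / δ) := Real.log_nonneg (one_le_one_div hδ hδ1)
  have : (0 : ℝ) ≤ n + d := by positivity
  rw [log_exp_one_div hδ]
  refine mul_le_mul hpow (measureReal_le_one.trans ?_) measureReal_nonneg (by positivity)
  linarith

theorem mul_measureReal_voteErrSet_add_six_le (hA : IsMeasurableLearner A) (hH : IsERM H A)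
    (hh : h ∈ H) {s : Fin (3 ^ (l + 6)) → X × Label} {T : List (X × Label)} {δ : ℝ} (hδ : 0 < δ)
    (hδ1 : δ ≤ 1) (hi : ∀ i, s ∉ regionFailure D A h d T (δ / 54) i)
    (hij : ∀ i j, i ≠ j → s ∉ voterFailure D A d T (δ / 1458) i j) :
    3 ^ (l + 6) * D.real (voteErrSet (10 / 243) (allVoters A (l + 6) (List.ofFn s) T)) ≤
      3 ^ 18 * (errCount h (List.ofFn s ++ T) + d + Real.log (Real.exp 1 / δ)) := by
  set B : ℝ := errCount h (List.ofFn s ++ T) + d + Real.log (Real.exp 1 / δ) with hB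
  have hB0 : 0 ≤ B := by
    have hlog : 0 ≤ Real.log (1 / δ) := Real.log_nonneg (one_le_one_div hδ hδ1)
    rw [hB, log_exp_one_div hδ]
    positivity
  have hV (i : Fin 27) (q : Fin (27 ^ (l / 6))) : MeasurableSet (errSet (blockVoters A s T i q)) :=
    measurableSet_errSet ((hA.measurable_blockVoters T i q).comp measurable_prodMk_left)
  calc 3 ^ (l + 6) * D.real (voteErrSet (10 / 243) (allVoters A (l + 6) (List.ofFn s) T))
      ≤ 3 ^ (l + 6) * (9 * 729 * (1200 * B / (26 * 3 ^ l))) := by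
        gcongr
        exact measureReal_voteErrSet_allVoters_add_six_le D hV (by positivity) fun i j hne q =>
          measureReal_inter_le_of_notMem_voterFailure D hH hh hδ hδ1 (hi i) (hij i j hne) q
    _ = 729 * 9 * 729 * 1200 / 26 * B := by field_simp; ring
    _ ≤ 3 ^ 18 * B := by gcongr; norm_num

/-- If some classifier of `H` makes few errors on the sample, then with high probability the region
where a `10 / 243` fraction of all voters errs is small. The constant `3 ^ 18` is large enough to
absorb the increase of the confidence parameter by a factor of `1458` in the recursion. -/
theorem pi_lt_mul_voteErrSet_allVoters_le (hd : ∀ F : Finset X, Shatters H F → F.card ≤ d)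
    (hH : IsERM H A) (hA : IsMeasurableLearner A) (hh : h ∈ H) (hhm : Measurable h) (k : ℕ)
    (T : List (X × Label)) {δ : ℝ} (hδ : 0 < δ) (hδ1 : δ ≤ 1) :
    (Measure.pi fun _ : Fin (3 ^ k) => D)
      {s | 3 ^ 18 * (errCount h (List.ofFn s ++ T) + d + Real.log (Real.exp 1 / δ)) <
        (3 : ℝ) ^ k * D.real (voteErrSet (10 / 243) (allVoters A k (List.ofFn s) T))} ≤
      ENNReal.ofReal δ := by
  induction k using Nat.strong_induction_on generalizing T δ with
  | _ k ih =>
  rcases lt_or_ge k 6 with hk | hk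
  · refine (measure_mono_null (fun s hs => ?_) measure_empty).trans_le zero_le
    exact absurd (show _ < _ from hs)
      (not_lt.2 (pow_mul_measureReal_le_of_lt_six D hk hδ hδ1 _ _ _))
  obtain ⟨l, rfl⟩ := Nat.exists_eq_add_of_le' hk
  calc _ ≤ (Measure.pi fun _ => D) ((⋃ i, regionFailure D A h d T (δ / 54) i) ∪
          ⋃ i, ⋃ j, {s | i ≠ j ∧ s ∈ voterFailure D A d T (δ / 1458) i j}) := by
        refine measure_mono fun s hs => ?_
        contrapose! hs
        simp only [Set.mem_union, Set.mem_iUnion, not_or, not_exists, Set.mem_ofPred_eq,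
          not_and] at hs
        exact not_lt.2 (mul_measureReal_voteErrSet_add_six_le D hA hH hh hδ hδ1 hs.1 hs.2)
    _ ≤ ENNReal.ofReal (Fintype.card (Fin 27) * (δ / 54) +
          Fintype.card (Fin 27) ^ 2 * (δ / 1458)) :=
        measure_iUnion_union_iUnion_iUnion_le (by positivity) (by positivity)
          (pi_regionFailure_le D hA hhm
            (fun T => ih l (by omega) T (by positivity) (by linarith)) T)
          fun i j => pi_voterFailure_le D hd hH hA T (by positivity)
    _ = ENNReal.ofReal δ := by
        rw [Fintype.card_fin]
        ring_nf

end Recursion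

section Deviation

theorem one_sub_le_measureReal_of_compl_le {Ω : Type*} [MeasurableSpace Ω] {μ : Measure Ω}
    [IsProbabilityMeasure μ] {G : Set Ω} {δ : ℝ} (hδ : 0 ≤ δ) (h : μ Gᶜ ≤ ENNReal.ofReal δ) :
    1 - δ ≤ μ.real G := by
  have hcompl : μ.real Gᶜ ≤ δ := ENNReal.toReal_le_of_le_ofReal hδ h
  have hunion : μ.real (G ∪ Gᶜ) ≤ μ.real G + μ.real Gᶜ := measureReal_union_le G Gᶜ
  rw [Set.union_compl_self, probReal_univ] at hunion
  linarith

/-- Hoeffding's inequality. -/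
theorem measureReal_pi_mul_le_sum_le {ι Q : Type*} [Fintype ι] [MeasurableSpace Q] {μ : Measure Q}
    [IsProbabilityMeasure μ] {f : Q → ℝ} (hf : Measurable f) (hf01 : ∀ q, f q ∈ Set.Icc 0 1)
    {ε : ℝ} (hε : 0 ≤ ε) :
    (Measure.pi fun _ : ι => μ).real
        {r | (μ[f] + ε) * Fintype.card ι ≤ ∑ i, f (r i)} ≤
      Real.exp (-(2 * Fintype.card ι * ε ^ 2)) := by
  rcases isEmpty_or_nonempty ι with hι | hι
  · simp
  have hsub (i : ι) : HasSubgaussianMGF (fun r : ι → Q => f (r i) - μ[f]) ((‖(1 : ℝ) - 0‖₊ / 2) ^ 2)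
      (Measure.pi fun _ : ι => μ) := by
    refine HasSubgaussianMGF.of_map (X := fun q => f q - μ[f]) (Y := fun r : ι → Q => r i)
      (measurable_pi_apply i).aemeasurable ?_
    rw [(measurePreserving_eval (fun _ : ι => μ) i).map_eq]
    exact hasSubgaussianMGF_of_mem_Icc hf.aemeasurable (.of_forall hf01)
  have hindep : iIndepFun (fun (i : ι) (r : ι → Q) => f (r i) - μ[f])
      (Measure.pi fun _ : ι => μ) :=
    iIndepFun_pi (X := fun (_ : ι) q => f q - μ[f]) fun _ => (hf.sub_const _).aemeasurable
  have hset : {r : ι → Q | (μ[f] + ε) * Fintype.card ι ≤ ∑ i, f (r i)} =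
      {r | ε * Fintype.card ι ≤ ∑ i, (f (r i) - μ[f])} := by
    ext r
    simp only [Set.mem_ofPred_eq, Finset.sum_sub_distrib, Finset.sum_const, Finset.card_univ,
      nsmul_eq_mul]
    constructor <;> intro h <;> linarith
  rw [hset]
  refine (HasSubgaussianMGF.measure_sum_ge_le_of_iIndepFun hindep (fun i _ => hsub i)
    (by positivity)).trans_eq ?_
  congr 1
  simp only [sub_zero, nnnorm_one, Finset.sum_const, Finset.card_univ, nsmul_eq_mul,
    NNReal.coe_mul, NNReal.coe_natCast, NNReal.coe_div, NNReal.coe_pow, NNReal.coe_one,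
    NNReal.coe_ofNat]
  field_simp

variable {X : Type*} [MeasurableSpace X]

/-- Chernoff's bound, from the mean of `2 ^ errCount h`. -/
theorem pi_lt_errCount_le (D : Measure (X × Label)) [IsProbabilityMeasure D] {h : Hyp X}
    (hh : Measurable h) {n : ℕ} {δ : ℝ} (hδ : 0 < δ) :
    (Measure.pi fun _ : Fin n => D)
      {s | 2 * (n * trueError D h + Real.log (1 / δ)) < errCount h (List.ofFn s)} ≤
      ENNReal.ofReal δ := by
  let f : (Fin n → X × Label) → ℝ≥0∞ := fun s => ∏ i, weight (1 + 1) (errSet h) (s i)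
  have hB : MeasurableSet (errSet h) := measurableSet_errSet hh
  have hfm : Measurable f := Finset.measurable_fun_prod _ fun i _ =>
    (measurable_weight _ hB).comp (measurable_pi_apply i)
  have hf : ∫⁻ s, f s ∂(Measure.pi fun _ => D) ≤ ENNReal.ofReal (Real.exp (n * trueError D h)) := by
    rw [lintegral_prod_weight_one_add D 1 hB, Fintype.card_fin, Real.exp_nat_mul,
      ENNReal.ofReal_pow (Real.exp_pos _).le, one_mul, ← ofReal_measureReal, ← ENNReal.ofReal_one,
      ← ENNReal.ofReal_add zero_le_one measureReal_nonneg]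
    gcongr
    rw [add_comm]
    exact Real.add_one_le_exp _
  have hsub : {s | 2 * (n * trueError D h + Real.log (1 / δ)) < errCount h (List.ofFn s)} ⊆
      {s | ENNReal.ofReal (Real.exp (n * trueError D h + Real.log (1 / δ))) ≤ f s} := by
    intro s hs
    simp only [Set.mem_ofPred_eq, f, prod_weight_errSet, one_add_one_eq_two] at hs ⊢
    rw [← ENNReal.ofReal_ofNat 2, ← ENNReal.ofReal_pow zero_le_two]
    refine ENNReal.ofReal_le_ofReal ?_
    rw [← Real.exp_log (show (0 : ℝ) < 2 ^ errCount h (List.ofFn s) by positivity), Real.log_pow,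
      Real.exp_le_exp]
    have : (errCount h (List.ofFn s) : ℝ) * (1 / 2) ≤ errCount h (List.ofFn s) * Real.log 2 := by
      gcongr
      linarith [Real.log_two_gt_d9]
    linarith
  exact (measure_mono hsub).trans (measure_ofReal_exp_add_log_le hfm hδ hf)

end Deviation

section Draws

instance (k t : ℕ) : IsProbabilityMeasure (drawLaw k t) := by
  unfold drawLaw
  infer_instance

variable {X : Type*} {k t : ℕ} {α : ℝ}

theorem integral_uniformOn_indicator_errSet {n : ℕ} (V : Fin n → Hyp X) (z : X × Label) :
    ∫ q, (errSet (V q)).indicator 1 z ∂(uniformOn Set.univ : Measure (Fin n)) = avgErr V z := by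
  rw [integral_fintype .of_finite, avgErr_eq_sum_indicator, Finset.sum_div]
  refine Finset.sum_congr rfl fun q _ => ?_
  simp [measureReal_def, uniformOn_univ, div_eq_inv_mul]

theorem drawLaw_add_le_avgErr_le (V : Fin (27 ^ (k / 6)) → Hyp X) {z : X × Label}
    (hz : avgErr V z ≤ α) {ε : ℝ} (hε : 0 ≤ ε) :
    drawLaw k t {r | α + ε ≤ avgErr (fun i => V (r i)) z} ≤
      ENNReal.ofReal (Real.exp (-(2 * t * ε ^ 2))) := by
  rcases t.eq_zero_or_pos with rfl | ht
  · simpa using prob_le_one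
  have hoeff := measureReal_pi_mul_le_sum_le (ι := Fin t)
    (μ := (uniformOn Set.univ : Measure (Fin (27 ^ (k / 6)))))
    (f := fun q => (errSet (V q)).indicator 1 z) (measurable_of_finite _)
    (fun q => by by_cases hq : z ∈ errSet (V q) <;> simp [hq]) hε
  rw [integral_uniformOn_indicator_errSet, Fintype.card_fin] at hoeff
  rw [← ofReal_measureReal]
  refine ENNReal.ofReal_le_ofReal ((measureReal_mono fun r hr => ?_).trans hoeff)
  rw [Set.mem_ofPred_eq, avgErr_eq_sum_indicator, le_div_iff₀ (by positivity)] at hr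
  exact le_trans (by gcongr) hr

variable [MeasurableSpace X] {A : Learner X} {m : ℕ}

theorem IsMeasurableLearner.measurable_drawnVoters (hA : IsMeasurableLearner A) (k : ℕ)
    (i : Fin t) :
    Measurable fun p : ((Fin m → X × Label) × (Fin t → Fin (27 ^ (k / 6)))) × X =>
      drawnVoters A k (List.ofFn p.1.1) p.1.2 i p.2 := by
  have hjoint : Measurable fun p : Fin (27 ^ (k / 6)) × ((Fin m → X × Label) × X) =>
      allVoters A k (List.ofFn p.2.1) [] p.1 p.2.2 :=
    measurable_from_prod_countable_right fun j =>
      hA.measurable_allVoters (.ofFn measurable_id) (.const []) k j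
  exact hjoint.comp (f := fun p : ((Fin m → X × Label) × (Fin t → Fin (27 ^ (k / 6)))) × X =>
    (p.1.2 i, (p.1.1, p.2))) (by fun_prop)

theorem prod_lt_measureReal_voteErrSet_drawnVoters_diff_le (D : Measure (X × Label))
    [IsProbabilityMeasure D] (hA : IsMeasurableLearner A) (k t : ℕ) (α : ℝ) {ε δ : ℝ} (hε : 0 ≤ ε)
    (hδ : 0 < δ) :
    ((Measure.pi fun _ : Fin m => D).prod (drawLaw k t))
      {ω | Real.exp (-(2 * t * ε ^ 2)) / δ <
        D.real (voteErrSet (α + ε) (drawnVoters A k (List.ofFn ω.1) ω.2) \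
          voteErrSet α (allVoters A k (List.ofFn ω.1) []))} ≤ ENNReal.ofReal δ := by
  let F : Set (((Fin m → X × Label) × (Fin t → Fin (27 ^ (k / 6)))) × (X × Label)) :=
    {p | p.2 ∈ voteErrSet (α + ε) (drawnVoters A k (List.ofFn p.1.1) p.1.2)} \
      {p | p.2 ∈ voteErrSet α (allVoters A k (List.ofFn p.1.1) [])}
  have hF : MeasurableSet F := by
    refine (measurableSet_prod_voteErrSet (α + ε) (V := fun ω : (Fin m → X × Label) × _ =>
      drawnVoters A k (List.ofFn ω.1) ω.2) fun i => ?_).diff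
        (measurableSet_prod_voteErrSet α (V := fun ω : (Fin m → X × Label) × _ =>
          allVoters A k (List.ofFn ω.1) []) fun j => ?_)
    · exact hA.measurable_drawnVoters k i
    · exact hA.measurable_allVoters (.ofFn measurable_fst) (.const []) k j
  have hdraw (z : X × Label) (s : Fin m → X × Label) :
      drawLaw k t {r | ((s, r), z) ∈ F} ≤ ENNReal.ofReal (Real.exp (-(2 * t * ε ^ 2))) := by
    by_cases hz : avgErr (allVoters A k (List.ofFn s) []) z ≤ α
    · exact (measure_mono fun r hr => hr.1).trans (drawLaw_add_le_avgErr_le _ hz hε)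
    · exact (measure_mono_null (fun r hr => hr.2 (le_of_not_ge hz)) measure_empty).trans_le zero_le
  exact measure_setOf_div_lt_section_le hF (Real.exp_pos _) hδ fun z =>
    prod_measure_le_of_forall_section_le (hF.preimage measurable_prodMk_right) (hdraw z)

end Draws

section Conclusion

variable {X : Type*} [MeasurableSpace X] (D : Measure (X × Label))

theorem bestError_nonneg (H : Set (Hyp X)) : 0 ≤ bestError D H :=
  Real.sInf_nonneg (by rintro _ ⟨h, -, rfl⟩; exact measureReal_nonneg)

theorem exists_trueError_lt_bestError_add {H : Set (Hyp X)} (hH : H.Nonempty) {ε : ℝ}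
    (hε : 0 < ε) : ∃ h ∈ H, trueError D h < bestError D H + ε := by
  obtain ⟨_, ⟨h, hh, rfl⟩, hlt⟩ :=
    exists_lt_of_csInf_lt (hH.image (trueError D)) (lt_add_of_pos_right (bestError D H) hε)
  exact ⟨h, hh, hlt⟩

variable [IsProbabilityMeasure D]

theorem exp_neg_le_inv_of_log_le {x y : ℝ} (hy : 0 < y) (h : Real.log y ≤ x) :
    Real.exp (-x) ≤ y⁻¹ := by
  rw [Real.exp_neg]
  gcongr
  exact (Real.log_le_iff_le_exp hy).1 h

theorem exp_neg_div_le {δ x m t : ℝ} (hδ : 0 < δ) (hx : 0 < x) (hm : 0 < m) (ht0 : 0 ≤ t)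
    (ht : 4 * 243 ^ 2 * Real.log (2 * m / (δ * x)) ≤ t) :
    Real.exp (-(2 * t * (1 / 243) ^ 2)) / (δ / 3) ≤ 3 * x / (2 * m) := by
  calc _ ≤ (2 * m / (δ * x))⁻¹ / (δ / 3) := by
        gcongr
        exact exp_neg_le_inv_of_log_le (by positivity) (by linarith)
    _ = 3 * x / (2 * m) := by field_simp

theorem measureReal_le_of_mul_measureReal_le_of_diff_le {B V : Set (X × Label)} {δ τ e m : ℝ}
    {d : ℕ} (hδ : 0 < δ) (hδ1 : δ ≤ 1) (hm : 0 < m)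
    (hB : m * D.real B ≤ 3 ^ 18 * (e + d + Real.log (Real.exp 1 / (δ / 3))))
    (he : e ≤ 2 * (m * τ + Real.log (1 / (δ / 3))))
    (hV : D.real (V \ B) ≤ 3 * (d + Real.log (1 / δ)) / (2 * m)) :
    D.real V ≤ 2 * 3 ^ 18 * τ + 8 * 3 ^ 18 * (d + Real.log (Real.exp 1 / δ)) / m := by
  have hlog : 0 ≤ Real.log (1 / δ) := Real.log_nonneg (one_le_one_div hδ hδ1)
  have hlog3 := log_one_div_div_le hδ (a := 3) (n := 2) (by norm_num) (by norm_num)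
  have hdiff : D.real V - D.real B ≤ D.real (V \ B) := le_measureReal_sdiff
  rw [log_exp_one_div (by positivity)] at hB ⊢
  rw [le_div_iff₀ (by positivity)] at hV
  have hmV : m * D.real V ≤ m * D.real B + m * D.real (V \ B) := by
    rw [← mul_add]
    gcongr
    linarith
  have : (0 : ℝ) ≤ d := Nat.cast_nonneg d
  rw [← sub_le_iff_le_add', le_div_iff₀ hm]
  push_cast at hlog3
  linarith

theorem prod_lt_voteError_drawnVoters_le {H : Set (Hyp X)} {A : Learner X} {h : Hyp X} {d : ℕ}
    (hd : ∀ F : Finset X, Shatters H F → F.card ≤ d) (hH : IsERM H A) (hA : IsMeasurableLearner A)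
    (hh : h ∈ H) (hhm : Measurable h) (k t : ℕ) {δ : ℝ} (hδ : 0 < δ) (hδ1 : δ < 1)
    (ht : 4 * 243 ^ 2 * Real.log (2 * 3 ^ k / (δ * (d + Real.log (1 / δ)))) ≤ t) :
    ((Measure.pi fun _ : Fin (3 ^ k) => D).prod (drawLaw k t))
      {ω | 2 * 3 ^ 18 * trueError D h + 8 * 3 ^ 18 * (d + Real.log (Real.exp 1 / δ)) / 3 ^ k <
        voteError D (11 / 243) (drawnVoters A k (List.ofFn ω.1) ω.2)} ≤ ENNReal.ofReal δ := by
  set μ := (Measure.pi fun _ : Fin (3 ^ k) => D).prod (drawLaw k t)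
  let B₁ : Set (Fin (3 ^ k) → X × Label) :=
    {s | 3 ^ 18 * (errCount h (List.ofFn s ++ []) + d + Real.log (Real.exp 1 / (δ / 3))) <
      (3 : ℝ) ^ k * D.real (voteErrSet (10 / 243) (allVoters A k (List.ofFn s) []))}
  let B₂ : Set (Fin (3 ^ k) → X × Label) :=
    {s | 2 * ((3 ^ k : ℕ) * trueError D h + Real.log (1 / (δ / 3))) < errCount h (List.ofFn s)}
  let B₃ : Set ((Fin (3 ^ k) → X × Label) × (Fin t → Fin (27 ^ (k / 6)))) :=
    {ω | Real.exp (-(2 * t * (1 / 243) ^ 2)) / (δ / 3) <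
      D.real (voteErrSet (10 / 243 + 1 / 243) (drawnVoters A k (List.ofFn ω.1) ω.2) \
        voteErrSet (10 / 243) (allVoters A k (List.ofFn ω.1) []))}
  have hL : 0 < Real.log (1 / δ) := Real.log_pos (one_lt_one_div hδ hδ1)
  have hμ₁ : μ (B₁ ×ˢ Set.univ) ≤ ENNReal.ofReal (δ / 3) := by
    rw [Measure.prod_prod, measure_univ, mul_one]
    exact pi_lt_mul_voteErrSet_allVoters_le D hd hH hA hh hhm k [] (by positivity) (by linarith)
  have hμ₂ : μ (B₂ ×ˢ Set.univ) ≤ ENNReal.ofReal (δ / 3) := by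
    rw [Measure.prod_prod, measure_univ, mul_one]
    exact pi_lt_errCount_le D hhm (by positivity)
  have hμ₃ : μ B₃ ≤ ENNReal.ofReal (δ / 3) :=
    prod_lt_measureReal_voteErrSet_drawnVoters_diff_le D hA k t _ (by norm_num) (by positivity)
  calc _ ≤ μ (B₁ ×ˢ Set.univ ∪ B₂ ×ˢ Set.univ ∪ B₃) := by
        refine measure_mono fun ω hω => ?_
        contrapose! hω
        simp only [Set.mem_union, Set.mem_prod, Set.mem_univ, and_true, not_or, B₁, B₂, B₃,
          Set.mem_ofPred_eq, not_lt, List.append_nil, Nat.cast_pow, Nat.cast_ofNat] at hω ⊢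
        obtain ⟨⟨hω₁, hω₂⟩, hω₃⟩ := hω
        have hV := hω₃.trans (exp_neg_div_le hδ (by positivity) (by positivity) t.cast_nonneg ht)
        rw [show (10 / 243 + 1 / 243 : ℝ) = 11 / 243 by norm_num] at hV
        exact measureReal_le_of_mul_measureReal_le_of_diff_le D hδ hδ1.le (by positivity) hω₁ hω₂ hV
    _ ≤ ENNReal.ofReal (δ / 3) + ENNReal.ofReal (δ / 3) + ENNReal.ofReal (δ / 3) :=
        (measure_union_le _ _).trans (by gcongr; exact (measure_union_le _ _).trans (by gcongr))
    _ = ENNReal.ofReal δ := by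
        rw [← ENNReal.ofReal_add (by positivity) (by positivity),
          ← ENNReal.ofReal_add (by positivity) (by positivity)]
        ring_nf

end Conclusion

end AgnosticVoting

theorem mainTheorem3 :
    ∃ c : ℝ, 1 ≤ c ∧
      ∀ (X : Type*) [MeasurableSpace X] (H : Set (AgnosticVoting.Hyp X)) (d : ℕ),
        (∀ h ∈ H, Measurable h) → AgnosticVoting.HasVCDim H d →
      ∀ A : AgnosticVoting.Learner X,
        AgnosticVoting.IsERM H A → AgnosticVoting.IsMeasurableLearner A →
      ∀ (D : Measure (X × AgnosticVoting.Label)) [IsProbabilityMeasure D]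
        (δ : ℝ), 0 < δ → δ < 1 →
      ∀ k m : ℕ, 6 ≤ k → m = 3 ^ k →
      ∀ t : ℕ,
        4 * 243 ^ 2 * Real.log (2 * (m : ℝ) / (δ * ((d : ℝ) + Real.log (1 / δ)))) ≤ (t : ℝ) →
      1 - δ ≤
        ((Measure.pi fun _ : Fin m => D).prod (AgnosticVoting.drawLaw k t)).real
          {ω | AgnosticVoting.voteError D (11 / 243)
                  (AgnosticVoting.drawnVoters A k (List.ofFn ω.1) ω.2) ≤
                c * AgnosticVoting.bestError D H +
                  c * ((d : ℝ) + Real.log (Real.exp 1 / δ)) / (m : ℝ)} := by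
  open AgnosticVoting in
  refine ⟨10 * 3 ^ 18, by norm_num, fun X _ H d hHm hd A hERM hA D _ δ hδ hδ1 k m _ hm t ht => ?_⟩
  subst hm
  have hm : (0 : ℝ) < (3 ^ k : ℕ) := by positivity
  obtain ⟨h, hh, hτ⟩ := exists_trueError_lt_bestError_add D hd.nonempty (one_div_pos.2 hm)
  have hx : 1 ≤ d + Real.log (Real.exp 1 / δ) := by
    have hL : 0 < Real.log (1 / δ) := Real.log_pos (one_lt_one_div hδ hδ1)
    have : (0 : ℝ) ≤ d := d.cast_nonneg
    rw [log_exp_one_div hδ]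
    linarith
  have hbound : 2 * 3 ^ 18 * trueError D h +
      8 * 3 ^ 18 * (d + Real.log (Real.exp 1 / δ)) / (3 ^ k : ℕ) ≤
      10 * 3 ^ 18 * bestError D H +
        10 * 3 ^ 18 * (d + Real.log (Real.exp 1 / δ)) / (3 ^ k : ℕ) := by
    have := div_le_div_of_nonneg_right hx hm.le
    have := bestError_nonneg D H
    simp only [mul_div_assoc]
    linarith
  refine one_sub_le_measureReal_of_compl_le hδ.le ((measure_mono fun ω hω => ?_).trans
    (prod_lt_voteError_drawnVoters_le D (fun F => hd.card_le) hERM hA hh (hHm h hh) k t hδ hδ1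
      (by exact_mod_cast ht)))
  exact_mod_cast hbound.trans_lt (not_le.1 hω)
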